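/- **Setting.** Let $G$ be a group and let $\mathcal H=\bigoplus_{g\in G}\mathcal H_g$ be a Hilbert space direct sum. Let $L_0$ be a self-adjoint operator on $\mathcal H$ that leaves each $\mathcal H_g$ invariant and has spectrum in $d_g+\{0,1,2,\dots\}$ there, with $d_g\ge 0$. Let $\mathcal H_g^{\mathrm{fin}}$ be the algebraic linear span of the eigenspaces of $L_0$ in $\mathcal H_g$, let $\mathcal D=\bigoplus^{\mathrm{alg}}_{g}\mathcal H_g^{\mathrm{fin}}$, and let $C^\infty(L_0)=\bigcap_{\ell\in\mathbb N}\mathrm{dom}(L_0^\ell)$. Let $L_m$ ($m\in\mathbb Z$), extending $L_0|_{\mathcal D}$, be operators on $\mathcal D$ that preserve each $\mathcal H_g^{\mathrm{fin}}$ and form a unitary representation of the Virasoro algebra with some central charge ($\langle L_mx,y\rangle=\langle x,L_{-m}y\rangle$), and let $\phi_{j,m}$ ($j\in J$, $m\in\mathbb Z$) be operators on $\mathcal D$ preserving each $\mathcal H_g^{\mathrm{fin}}$ (the Fourier components of the chiral fields). In the typical case $\mathcal H_g$ is the representation space of an automorphism $\kappa(g)$ of a conformal net on $S^1$. Let $\psi^h(\xi,s)$,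 for $h\in G$, $\xi$ in an index set $\Xi_h$ and $s\in\mathbb R$, be operators on $\mathcal D$, let $D_h\ge 0$ and $\alpha(h_1,h_2)\in\mathbb R$ ($h,h_1,h_2\in G$), and put $\psi^h(\xi,z)=\sum_{s\in\mathbb R}\psi^h(\xi,s)z^{-s-D_h}$ as a formal series. Assume that they are charged primary fields with polynomial energy bounds, that is: 1. $\psi^h(\xi,s)$ maps $\mathcal H_g^{\mathrm{fin}}$ into $\mathcal H_{hg}^{\mathrm{fin}}$, and for all $h,g$ there is $\ell_{h,g}\in\mathbb R$ such that $\psi^h(\xi,s)$ is nonzero on $\mathcal H_g^{\mathrm{fin}}$ only for $s\in\ell_{h,g}+\mathbb Z$; 2. $[L_m,\psi^h(\xi,s)]=((D_h-1)m-s)\,\psi^h(\xi,m+s)$; 3. $[\phi_{j,m},\psi^h(\xi,s)]=\sum_{\xi'\in\Xi_h}X^{\xi}_{j,\xi'}\psi^h(\xi',m+s)$ for some $X^{\xi}_{j,\xi'}\in\mathbb C$ (depending on $h$ but not on $m,s$), the sum converging unconditionally in norm on each vector of $\mathcal D$; 4. for all $h_1,h_2\in G$, $\xi_1\in\Xi_{h_1}$,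 $\xi_2\in\Xi_{h_2}$, the following identity of formal series in $w,z$ holds on each vector of $\mathcal D$: $$\left(1-\tfrac zw\right)^{\alpha(h_1,h_2)}w^{\alpha(h_1,h_2)}\,\psi^{h_1}(\xi_1,w)\psi^{h_2}(\xi_2,z)=\left(1-\tfrac wz\right)^{\alpha(h_1,h_2)}z^{\alpha(h_1,h_2)}\,\psi^{h_2}(\xi_2,z)\psi^{h_1}(\xi_1,w),$$ where $(1-u)^\beta=\sum_{n\ge0}\binom\beta n(-u)^n$; 5. for all $h,\xi$ there are $\bar h\in G$ and $\bar\xi\in\Xi_{\bar h}$ such that $\langle\psi^h(\xi,s)x,y\rangle=\langle x,\psi^{\bar h}(\bar\xi,-s)y\rangle$ for all $s\in\mathbb R$ and $x,y\in\mathcal D$; 6. for all $h,\xi$ there are $r,p,C\ge0$ such that $\|\psi^h(\xi,s)\Psi\|\le C(1+|s|)^r\|(L_0+1)^p\Psi\|$ for all $s\in\mathbb R$ and $\Psi\in\mathcal D$. By item 6, $\psi^h(\xi,s)$ extends to $C^\infty(L_0)$ by summing its values on the components of a vector of definite charge $g$ and energy (eigenvalue of $L_0$). For a smooth function $f$ on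 $S^1$ with support in $S^1\setminus\{-1\}$ put $f_s=\frac1{2\pi}\int_{-\pi}^{\pi}f(e^{i\theta})e^{-is\theta}\,d\theta$ ($s\in\mathbb R$) and $\psi^h(\xi,f)=\sum_{s\in\mathbb R}f_s\,\psi^h(\xi,s)$. **Lemma 5.4.** Let $h_1,h_2\in G$, $\xi_1\in\Xi_{h_1}$, $\xi_2\in\Xi_{h_2}$, and let $f,g$ be smooth functions on $S^1$ with supports in $S^1\setminus\{-1\}$ such that $\arg w<\arg z$ for all $w\in\operatorname{supp}f$, $z\in\operatorname{supp}g$, where $\arg$ takes values in $(-\pi,\pi)$ on $S^1\setminus\{-1\}$. Then the sums defining $\psi^{h_1}(\xi_1,f)$ and $\psi^{h_2}(\xi_2,g)$ converge unconditionally on every vector of $C^\infty(L_0)$ and define maps of $C^\infty(L_0)$ into itself, the limit $$\epsilon^+=\lim_{\zeta\to-1,\ \operatorname{Im}\zeta>0}\zeta^{\alpha(h_1,h_2)}$$ (principal branch) exists, and $$\psi^{h_1}(\xi_1,f)\,\psi^{h_2}(\xi_2,g)=\epsilon^+\,\psi^{h_2}(\xi_2,g)\,\psi^{h_1}(\xi_1,f)\qquad\text{on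 } C^\infty(L_0).$$ -/

import Mathlib

open scoped InnerProductSpace Manifold ContDiff Topology

noncomputable section

/-! ### Unbounded operators: eigenspaces and smooth vectors -/

section Operators

variable {E : Type*} [NormedAddCommGroup E] [InnerProductSpace ℂ E]

/-- The eigenspace `ker (T - t)` of an unbounded operator `T`, as a subspace of the whole space. -/
def eigenSubspace (T : E →ₗ.[ℂ] E) (t : ℝ) : Submodule ℂ E :=
  (LinearMap.ker (T.toFun - (t : ℂ) • T.domain.subtype)).map T.domain.subtype

theorem mem_eigenSubspace {T : E →ₗ.[ℂ] E} {t : ℝ} {x : E} :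
    x ∈ eigenSubspace T t ↔ ∃ hx : x ∈ T.domain, T ⟨x, hx⟩ = (t : ℂ) • x := by
  constructor
  · rintro ⟨y, hy, rfl⟩
    exact ⟨y.2, sub_eq_zero.mp hy⟩
  · rintro ⟨hx, h⟩
    exact ⟨⟨x, hx⟩, sub_eq_zero.mpr h, rfl⟩

theorem isClosed_eigenSubspace {T : E →ₗ.[ℂ] E} (hT : T.IsClosed) (t : ℝ) :
    IsClosed (eigenSubspace T t : Set E) := by
  have h : (eigenSubspace T t : Set E) =
      (fun x : E => (x, (t : ℂ) • x)) ⁻¹' (T.graph : Set (E × E)) := by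
    ext x
    simp only [SetLike.mem_coe, Set.mem_preimage, LinearPMap.mem_graph_iff, mem_eigenSubspace]
    constructor
    · rintro ⟨hx, h⟩
      exact ⟨⟨x, hx⟩, rfl, h⟩
    · rintro ⟨y, rfl, h⟩
      exact ⟨y.2, h⟩
  rw [h]
  exact IsClosed.preimage (by fun_prop) hT

/-- The domain of the power `T ^ l` of an unbounded operator `T`. -/
def powDomain (T : E →ₗ.[ℂ] E) : ℕ → Submodule ℂ E
  | 0 => ⊤
  | l + 1 => ((powDomain T l).comap T.toFun).map T.domain.subtype

/-- `C^∞(T)`, the intersection of the domains of all powers of `T`. -/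
def smoothVectors (T : E →ₗ.[ℂ] E) : Submodule ℂ E := ⨅ l : ℕ, powDomain T l

end Operators

/-! ### Direct sums of positive-energy representations -/

/-- A Hilbert space `𝓗`, the orthogonal direct sum of closed subspaces `sector g`, `g ∈ G`
(the representation spaces of the charges `g`), with a self-adjoint conformal Hamiltonian `L₀`
that leaves every sector invariant and has spectrum in `lowestEnergy g + {0, 1, 2, …}` on
`sector g`, where `lowestEnergy g ≥ 0`. As the spectrum is discrete on each sector, this is said
by: each sector is the closed span of its eigenvectors of these eigenvalues. -/
structure EnergyGrading (G : Type*) (𝓗 : Type*) [NormedAddCommGroup 𝓗] [InnerProductSpace ℂ 𝓗]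
    [CompleteSpace 𝓗] where
  sector : G → Submodule ℂ 𝓗
  isClosed_sector : ∀ g, IsClosed (sector g : Set 𝓗)
  sector_orthogonal : ∀ g g', g ≠ g' → sector g ⟂ sector g'
  dense_sector : (⨆ g, sector g).topologicalClosure = ⊤
  L₀ : 𝓗 →ₗ.[ℂ] 𝓗
  isSelfAdjoint_L₀ : IsSelfAdjoint L₀
  lowestEnergy : G → ℝ
  lowestEnergy_nonneg : ∀ g, 0 ≤ lowestEnergy g
  spectrum_sector : ∀ g,
    (⨆ n : ℕ, sector g ⊓ eigenSubspace L₀ (lowestEnergy g + n)).topologicalClosure = sector g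

namespace EnergyGrading

variable {G : Type*} {𝓗 : Type*} [NormedAddCommGroup 𝓗] [InnerProductSpace ℂ 𝓗]
  [CompleteSpace 𝓗] (S : EnergyGrading G 𝓗)

/-- Vectors of charge `g` and energy `t`. -/
def homog (g : G) (t : ℝ) : Submodule ℂ 𝓗 := S.sector g ⊓ eigenSubspace S.L₀ t

/-- The finite-energy vectors of charge `g`: the linear span of the eigenspaces of `L₀` there. -/
def finSector (g : G) : Submodule ℂ 𝓗 := ⨆ t : ℝ, S.homog g t

/-- The algebraic direct sum of the spaces of finite-energy vectors of all charges. -/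
def fin : Submodule ℂ 𝓗 := ⨆ g : G, S.finSector g

theorem homog_le_fin (g : G) (t : ℝ) : S.homog g t ≤ S.fin :=
  (le_iSup (S.homog g) t).trans (le_iSup S.finSector g)

instance completeSpace_homog (g : G) (t : ℝ) : CompleteSpace (S.homog g t) :=
  IsClosed.completeSpace_coe
    (hs := (S.isClosed_sector g).inter (isClosed_eigenSubspace S.isSelfAdjoint_L₀.isClosed t))

/-- The orthogonal projection onto the vectors of charge `i.1` and energy `i.2`, with values in
the finite-energy vectors. -/
def proj (i : G × ℝ) (Ψ : 𝓗) : S.fin :=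
  Submodule.inclusion (S.homog_le_fin i.1 i.2) ((S.homog i.1 i.2).orthogonalProjectionOnto Ψ)

/-- `(L₀ + 1) ^ p Ψ`, for a finite-energy vector `Ψ`, by the spectral decomposition
(only finitely many terms are nonzero). -/
def addOnePow (p : ℝ) (Ψ : S.fin) : 𝓗 :=
  ∑' i : G × ℝ, (((i.2 + 1) ^ p : ℝ) : ℂ) • (S.proj i (Ψ : 𝓗) : 𝓗)

/-- The value on `Ψ` of the extension of an operator `A`, given on finite-energy vectors and
satisfying an energy bound, to `C^∞(L₀)`: the sum of its values on the components of `Ψ`. -/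
def extend (A : Module.End ℂ S.fin) (Ψ : 𝓗) : 𝓗 :=
  ∑' i : G × ℝ, (A (S.proj i Ψ) : 𝓗)

end EnergyGrading

/-- A direct sum over `g ∈ G` of unitary positive-energy representations of the Virasoro algebra
on the finite-energy vectors, with common central charge `c`, together with the Fourier
components `φ j n` of a family of chiral fields, acting in every sector. -/
structure ChiralSectors (G : Type*) (J : Type*) (𝓗 : Type*) [NormedAddCommGroup 𝓗]
    [InnerProductSpace ℂ 𝓗] [CompleteSpace 𝓗] extends EnergyGrading G 𝓗 where
  c : ℝ
  L : ℤ → Module.End ℂ toEnergyGrading.fin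
  L_sector : ∀ m g (x : toEnergyGrading.fin),
    (x : 𝓗) ∈ toEnergyGrading.finSector g → (L m x : 𝓗) ∈ toEnergyGrading.finSector g
  L_zero : ∀ x : toEnergyGrading.fin, ∃ hx : (x : 𝓗) ∈ L₀.domain, (L 0 x : 𝓗) = L₀ ⟨x, hx⟩
  virasoro : ∀ m n, L m * L n - L n * L m =
    ((m : ℂ) - n) • L (m + n) +
      (if m + n = 0 then (c : ℂ) / 12 * ((m : ℂ) ^ 3 - m) else 0) • 1
  L_adjoint : ∀ m (x y : toEnergyGrading.fin), ⟪(L m x : 𝓗), y⟫_ℂ = ⟪(x : 𝓗), L (-m) y⟫_ℂ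
  φ : J → ℤ → Module.End ℂ toEnergyGrading.fin
  φ_sector : ∀ j n g (x : toEnergyGrading.fin),
    (x : 𝓗) ∈ toEnergyGrading.finSector g → (φ j n x : 𝓗) ∈ toEnergyGrading.finSector g

/-! ### Formal series

A formal series in one variable `z` (in two variables `w`, `z`), with arbitrary real exponents,
is represented by its coefficients: `a ↦` coefficient of `z ^ a`
(`a b ↦` coefficient of `w ^ a * z ^ b`). -/

section FormalSeries

variable {V : Type*} [AddCommGroup V] [Module ℂ V]

/-- The coefficient of `u ^ n` in `(1 - u) ^ β`, that is, `(-1) ^ n * binom β n`. -/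
def oneSubPowCoeff (β : ℝ) (n : ℕ) : ℝ :=
  (-1) ^ n * ((∏ i ∈ Finset.range n, (β - i)) / n.factorial)

/-- The formal series `A(z) = ∑ s, A s * z ^ (- s - D)`. -/
def fieldSeries (D : ℝ) (A : ℝ → Module.End ℂ V) : ℝ → Module.End ℂ V :=
  fun a => A (-a - D)

/-- The formal series `(1 - z / w) ^ β * w ^ β * F(w, z)`, evaluated at the vector `x`. For the
products of fields to which it is applied the sum has finitely many nonzero terms. -/
def mulLeftFactor (β : ℝ) (F : ℝ → ℝ → Module.End ℂ V) (x : V) : ℝ → ℝ → V :=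
  fun a b => ∑ᶠ n : ℕ, (oneSubPowCoeff β n : ℂ) • F (a - β + n) (b - n) x

/-- The formal series `(1 - w / z) ^ β * z ^ β * F(w, z)`, evaluated at the vector `x`. For the
products of fields to which it is applied the sum has finitely many nonzero terms. -/
def mulRightFactor (β : ℝ) (F : ℝ → ℝ → Module.End ℂ V) (x : V) : ℝ → ℝ → V :=
  fun a b => ∑ᶠ n : ℕ, (oneSubPowCoeff β n : ℂ) • F (a - n) (b - β + n) x

end FormalSeries

/-! ### Charged primary fields -/

/-- A family of charged primary fields `ψ h ξ`, `h ∈ G`, `ξ ∈ Ξ h`, with Fourier components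
`ψ h ξ s`, `s ∈ ℝ`, conformal dimensions `D h` and braiding exponents `α h₁ h₂`, that satisfies
polynomial energy bounds. -/
structure ChargedPrimaryFields {G : Type*} [Group G] {J : Type*} {𝓗 : Type*}
    [NormedAddCommGroup 𝓗] [InnerProductSpace ℂ 𝓗] [CompleteSpace 𝓗]
    (S : ChiralSectors G J 𝓗) (Ξ : G → Type*) where
  D : G → ℝ
  D_nonneg : ∀ h, 0 ≤ D h
  ψ : (h : G) → Ξ h → ℝ → Module.End ℂ S.fin
  ψ_sector : ∀ h ξ s g (x : S.fin),
    (x : 𝓗) ∈ S.finSector g → (ψ h ξ s x : 𝓗) ∈ S.finSector (h * g)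
  ψ_modes : ∀ h g, ∃ ℓ : ℝ, ∀ ξ s (x : S.fin),
    (x : 𝓗) ∈ S.finSector g → ψ h ξ s x ≠ 0 → ∃ n : ℤ, s = ℓ + n
  primarity : ∀ m h ξ s, S.L m * ψ h ξ s - ψ h ξ s * S.L m =
    (((D h - 1) * m - s : ℝ) : ℂ) • ψ h ξ (m + s)
  relativeLocality : ∀ h, ∃ X : J → Ξ h → Ξ h → ℂ, ∀ j (m : ℤ) ξ s (x : S.fin),
    HasSum (fun ξ' => X j ξ ξ' • (ψ h ξ' (m + s) x : 𝓗))
      (((S.φ j m * ψ h ξ s - ψ h ξ s * S.φ j m) x : S.fin) : 𝓗)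
  α : G → G → ℝ
  braiding : ∀ h₁ h₂ ξ₁ ξ₂ (x : S.fin),
    mulLeftFactor (α h₁ h₂)
        (fun a b => fieldSeries (D h₁) (ψ h₁ ξ₁) a * fieldSeries (D h₂) (ψ h₂ ξ₂) b) x =
      mulRightFactor (α h₁ h₂)
        (fun a b => fieldSeries (D h₂) (ψ h₂ ξ₂) b * fieldSeries (D h₁) (ψ h₁ ξ₁) a) x
  conjugation : ∀ h ξ, ∃ h' ξ', ∀ s (x y : S.fin),
    ⟪(ψ h ξ s x : 𝓗), y⟫_ℂ = ⟪(x : 𝓗), ψ h' ξ' (-s) y⟫_ℂ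
  energyBound : ∀ h ξ, ∃ r p C : ℝ, 0 ≤ r ∧ 0 ≤ p ∧ 0 ≤ C ∧ ∀ s (x : S.fin),
    ‖(ψ h ξ s x : 𝓗)‖ ≤ C * (1 + |s|) ^ r * ‖S.addOnePow p x‖

/-! ### Smeared fields -/

/-- Test functions on `S¹ ∖ {-1}`: smooth functions on the circle with support off `-1`. -/
structure IsTestFunction (f : Circle → ℂ) : Prop where
  smooth : ContMDiff (𝓡 1) 𝓘(ℝ, ℂ) ∞ f
  support : (-1 : Circle) ∉ tsupport f

/-- `f_s = (1 / 2π) ∫_{-π}^{π} f(e^{iθ}) e^{-isθ} dθ`, for real `s`. -/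
def circleCoeff (f : Circle → ℂ) (s : ℝ) : ℂ :=
  (1 / (2 * Real.pi) : ℝ) *
    ∫ θ in (-Real.pi)..Real.pi, f (Circle.exp θ) * Complex.exp (-(Complex.I * s * θ))

namespace EnergyGrading

variable {G : Type*} {𝓗 : Type*} [NormedAddCommGroup 𝓗] [InnerProductSpace ℂ 𝓗]
  [CompleteSpace 𝓗] (S : EnergyGrading G 𝓗)

/-- The value on `Ψ` of the smeared field `A(f) = ∑ s, f_s A s`. -/
def smear (A : ℝ → Module.End ℂ S.fin) (f : Circle → ℂ) (Ψ : 𝓗) : 𝓗 :=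
  ∑' s : ℝ, circleCoeff f s • S.extend (A s) Ψ

/-- The smeared field `A(f) = ∑ s, f_s A s` is an operator on `C^∞(L₀)`: the sums that define it
converge there, and its values lie in `C^∞(L₀)`. -/
def SmearDefined (A : ℝ → Module.End ℂ S.fin) (f : Circle → ℂ) : Prop :=
  ∀ Ψ ∈ smoothVectors S.L₀,
    (∀ s, Summable fun i : G × ℝ => (A s (S.proj i Ψ) : 𝓗)) ∧
    (Summable fun s : ℝ => circleCoeff f s • S.extend (A s) Ψ) ∧
    S.smear A f Ψ ∈ smoothVectors S.L₀

end EnergyGrading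

end

/-!
The matrix elements of the products `ψ₁(w) ψ₂(z)` and `ψ₂(z) ψ₁(w)` between vectors of definite
charge and energy are boundary values, from `|z| < |w|` and `|w| < |z|`, of one function: by the
braiding relation both become the same finite series after multiplication with the `α`-th power
of `1 - z / w`, resp. `1 - w / z`. The series is finite because the energy is bounded below on both
sides. As the coefficients of `(1 - u) ^ α` and `(1 - u) ^ (-α)` are inverse to each other
(`sum_antidiagonal_oneSubPowCoeff_neg`), the matrix elements themselves are the two expansions of
that finite series times a `(-α)`-th power. Smearing with test functions whose supports are ordered
by the angle keeps `ζ = z / w` away from `1`; there the expansions may be integrated up to the unit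
circle (`tsum_twoPoint`), where the two branches of the power differ by a constant phase
(`one_sub_exp_cpow_eq`), which is the limit `ε⁺`. This scalar statement is
`tsum_circleCoeff_eq_of_braiding`.

The smeared fields are defined on smooth vectors because modes map a vector of charge `g` and energy
`t` to one of charge `h * g` and energy `t - s`. Contributions to different charges or energies are
orthogonal, so only the sum over the modes `s` with a fixed target has to be controlled. These
modes lie in a translate of `ℤ`, and the Cauchy–Schwarz inequality with weights
`(1 + |s|) ^ (-2)`, together with the rapid decay of the Fourier coefficients and the energy bounds,
gives unconditional convergence (`EnergyGrading.summable_of_shift`). The same estimate with the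
terms multiplied by powers of the energy shows that the values are smooth.

Finally the conjugation property makes every smeared field the formal adjoint of another one on
smooth vectors. The two products therefore agree up to the phase on all smooth vectors as soon as
they do so between vectors of definite charge and energy.
-/

noncomputable section

/-! ### Binomial coefficients -/

theorem oneSubPowCoeff_eq_choose (β : ℝ) (n : ℕ) :
    oneSubPowCoeff β n = (-1) ^ n * Ring.choose β n := by
  have h : (descPochhammer ℤ n).smeval β = ∏ i ∈ Finset.range n, (β - i) := by
    induction n with
    | zero => simp
    | succ n ih =>
      rw [Finset.prod_range_succ, ← ih]
      simp [descPochhammer_succ_right, Polynomial.smeval_mul, Polynomial.smeval_natCast]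
  rw [oneSubPowCoeff, Ring.choose_eq_smul, h, smul_eq_mul, div_eq_inv_mul]

/-- The coefficients of `(1 - u) ^ (-β)` and of `(1 - u) ^ β` are inverse to each other under the
Cauchy product: this is the Chu–Vandermonde identity. -/
theorem sum_antidiagonal_oneSubPowCoeff_neg (β : ℝ) (n : ℕ) :
    ∑ p ∈ Finset.HasAntidiagonal.antidiagonal n,
      oneSubPowCoeff (-β) p.1 * oneSubPowCoeff β p.2 = if n = 0 then 1 else 0 := by
  have h := Ring.add_choose_eq (r := -β) (s := β) n (Commute.all _ _)
  rw [neg_add_cancel, Ring.choose_zero_ite] at h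
  calc _ = (-1) ^ n * ∑ p ∈ Finset.HasAntidiagonal.antidiagonal n,
        Ring.choose (-β) p.1 * Ring.choose β p.2 := by
        rw [Finset.mul_sum]
        refine Finset.sum_congr rfl fun p hp => ?_
        rw [oneSubPowCoeff_eq_choose, oneSubPowCoeff_eq_choose,
          ← Finset.HasAntidiagonal.mem_antidiagonal.mp hp, pow_add]
        ring
    _ = _ := by
        rw [← h]
        split_ifs with hn <;> simp [hn]

theorem exists_abs_oneSubPowCoeff_le (β : ℝ) :
    ∃ M : ℕ, ∀ n : ℕ, |oneSubPowCoeff β n| ≤ (n + 1 : ℝ) ^ M := by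
  obtain ⟨M, hM⟩ := exists_nat_ge |β|
  refine ⟨M + 1, fun n => ?_⟩
  induction n with
  | zero => simp [oneSubPowCoeff]
  | succ n ih =>
    have hrec : oneSubPowCoeff β (n + 1) = oneSubPowCoeff β n * (-((β - n) / (n + 1))) := by
      rw [oneSubPowCoeff, oneSubPowCoeff, Finset.prod_range_succ, Nat.factorial_succ]
      have : (n.factorial : ℝ) ≠ 0 := by positivity
      push_cast
      field_simp
      ring
    have hn : (0 : ℝ) < n + 1 := by positivity
    have h1 : |-((β - n) / (n + 1))| ≤ ((n + 2 : ℝ) / (n + 1)) ^ (M + 1) := by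
      have hb : 1 + ((M + 1 : ℕ) : ℝ) * (1 / (n + 1)) ≤ (1 + 1 / (n + 1 : ℝ)) ^ (M + 1) :=
        one_add_mul_le_pow (by have : (0 : ℝ) ≤ 1 / (n + 1) := by positivity
                               linarith) _
      have he : (1 + 1 / (n + 1 : ℝ)) = (n + 2) / (n + 1) := by field_simp; ring
      rw [he] at hb
      refine le_trans ?_ hb
      rw [abs_neg, abs_div, abs_of_pos hn, div_le_iff₀ hn]
      have : |β - n| ≤ |β| + n := by
        simpa using abs_sub β (n : ℝ)
      push_cast
      field_simp
      linarith
    rw [hrec, abs_mul]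
    calc _ ≤ (n + 1 : ℝ) ^ (M + 1) * ((n + 2 : ℝ) / (n + 1)) ^ (M + 1) := by gcongr
      _ = _ := by
        rw [← mul_pow]
        congr 1
        push_cast
        field_simp
        ring

theorem hasSum_oneSubPowCoeff (β : ℝ) {u : ℂ} (hu : ‖u‖ < 1) :
    HasSum (fun n : ℕ => (oneSubPowCoeff β n : ℂ) * u ^ n) ((1 - u) ^ (β : ℂ)) := by
  have h := (Complex.one_add_cpow_hasFPowerSeriesOnBall_zero (a := (β : ℂ))).hasSum
    (y := -u) (by
      rw [← ENNReal.ofReal_one, Metric.eball_ofReal]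
      simpa using hu)
  convert! h using 1
  · ext n
    simp only [binomialSeries_apply, oneSubPowCoeff_eq_choose, List.ofFn_const, List.prod_replicate,
      smul_eq_mul]
    push_cast
    rw [neg_pow u]
    ring
  · simp [sub_eq_add_neg]

/-! ### Boundary values of `(1 - ζ) ^ β` -/

theorem one_sub_exp_eq (x : ℝ) :
    1 - Complex.exp (x * Complex.I) =
      (2 * Real.sin (x / 2) : ℝ) * Complex.exp (((x - Real.pi) / 2 : ℝ) * Complex.I) := by
  have h1 : Complex.exp (((x - Real.pi) / 2 : ℝ) * Complex.I) =
      -Complex.I * Complex.exp ((x / 2 : ℂ) * Complex.I) := by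
    rw [← Complex.exp_neg_pi_div_two_mul_I, ← Complex.exp_add]
    congr 1; push_cast; ring
  have h2 : Complex.exp (x * Complex.I) = Complex.exp ((x / 2 : ℂ) * Complex.I) ^ 2 := by
    rw [← Complex.exp_nat_mul]; congr 1; push_cast; ring
  rw [h1, h2]
  push_cast
  rw [Complex.sin, neg_mul, Complex.exp_neg]
  have := Complex.exp_ne_zero ((x / 2 : ℂ) * Complex.I)
  field_simp
  ring_nf
  simp
  ring

theorem one_sub_exp_cpow {x : ℝ} (h0 : 0 < x) (h1 : x < 2 * Real.pi) (β : ℂ) :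
    (1 - Complex.exp (x * Complex.I)) ^ β =
      Complex.exp (β *
        (Real.log (2 * Real.sin (x / 2)) + ((x - Real.pi) / 2 : ℝ) * Complex.I)) := by
  have hs : 0 < 2 * Real.sin (x / 2) :=
    mul_pos two_pos (Real.sin_pos_of_pos_of_lt_pi (by linarith) (by linarith))
  have : 1 - Complex.exp (x * Complex.I) =
      Complex.exp (Real.log (2 * Real.sin (x / 2)) + ((x - Real.pi) / 2 : ℝ) * Complex.I) := by
    rw [Complex.exp_add, ← Complex.ofReal_exp, Real.exp_log hs, one_sub_exp_eq]
  rw [this, Complex.cpow_def_of_ne_zero (Complex.exp_ne_zero _), Complex.log_exp, mul_comm]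
  all_goals
    simp only [Complex.add_im, Complex.ofReal_im, Complex.mul_im, Complex.ofReal_re, Complex.I_im,
      Complex.I_re]
    linarith

/-- The branches `(1 - ζ) ^ β` and `(1 - ζ⁻¹) ^ β`, taken on the unit circle off `1`, differ by the
power `(-ζ) ^ β` with `-ζ = e^{i(x - π)}`, `x - π ∈ (-π, π)`. -/
theorem one_sub_exp_cpow_eq {x : ℝ} (h0 : 0 < x) (h1 : x < 2 * Real.pi) (β : ℂ) :
    (1 - Complex.exp (x * Complex.I)) ^ β =
      Complex.exp (β * (x - Real.pi) * Complex.I) *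
        (1 - Complex.exp (-(x * Complex.I))) ^ β := by
  have h2 : Complex.exp (-(x * Complex.I)) =
      Complex.exp (((2 * Real.pi - x : ℝ) : ℂ) * Complex.I) := by
    rw [← Complex.exp_periodic (-(x * Complex.I))]
    congr 1; push_cast; ring
  have h3 : Real.sin ((2 * Real.pi - x) / 2) = Real.sin (x / 2) := by
    rw [← Real.sin_pi_sub]; congr 1; ring
  rw [h2, one_sub_exp_cpow h0 h1, one_sub_exp_cpow (by linarith) (by linarith), h3,
    ← Complex.exp_add]
  congr 1; push_cast; ring

theorem one_sub_smul_exp_mem_slitPlane {r x : ℝ} (hr0 : 0 ≤ r) (hr1 : r ≤ 1)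
    (hx : Real.cos x < 1) : 1 - (r : ℂ) * Complex.exp (x * Complex.I) ∈ Complex.slitPlane := by
  refine Or.inl ?_
  have : (1 - (r : ℂ) * Complex.exp (x * Complex.I)).re = 1 - r * Real.cos x := by
    simp [Complex.exp_ofReal_mul_I_re]
  rw [this]
  rcases hr1.lt_or_eq with h | rfl
  · nlinarith [Real.cos_le_one x]
  · linarith

theorem cos_lt_one_of_mem {x : ℝ} (h0 : 0 < x) (h1 : x < 2 * Real.pi) : Real.cos x < 1 :=
  lt_of_le_of_ne (Real.cos_le_one x) fun h =>
    h0.ne' ((Real.cos_eq_one_iff_of_lt_of_lt (by linarith) h1).mp h)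

/-! ### Rapid decay of Fourier coefficients -/

/-- A function on the line that decays faster than every power. -/
def RapidDecay (φ : ℝ → ℂ) : Prop := ∀ M : ℕ, ∃ K : ℝ, ∀ s, ‖φ s‖ * (1 + |s|) ^ M ≤ K

/-- The test function `f` as a function of the angle `θ ∈ (-π, π)`, extended by zero to the
line. -/
def angleFun (f : Circle → ℂ) : ℝ → ℂ :=
  (Set.Ioo (-Real.pi) Real.pi).indicator fun θ => f (Circle.exp θ)

theorem mem_slitPlane_of_ne_neg_one {z : Circle} (hz : z ≠ -1) : (z : ℂ) ∈ Complex.slitPlane := by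
  rw [Complex.mem_slitPlane_iff_arg]
  refine ⟨fun h => hz ?_, by simp⟩
  rw [← Circle.exp_arg z, h]
  ext; simp

theorem tsupport_angleFun_subset {f : Circle → ℂ} (hf : (-1 : Circle) ∉ tsupport f) :
    tsupport (angleFun f) ⊆ (fun z : Circle => Complex.arg z) '' tsupport f ∧
      IsCompact ((fun z : Circle => Complex.arg z) '' tsupport f) := by
  have hc : IsCompact ((fun z : Circle => Complex.arg z) '' tsupport f) := by
    refine (isClosed_tsupport f).isCompact.image_of_continuousOn fun z hz => ?_
    have h := mem_slitPlane_of_ne_neg_one (z := z) (fun h => hf (h ▸ hz))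
    exact ((Complex.continuousAt_arg h).comp
      (f := fun z : Circle => (z : ℂ)) (by fun_prop)).continuousWithinAt
  refine ⟨closure_minimal (fun θ hθ => ?_) hc.isClosed, hc⟩
  have hθ' : θ ∈ Set.Ioo (-Real.pi) Real.pi := Set.mem_of_indicator_ne_zero hθ
  have : f (Circle.exp θ) ≠ 0 := by
    rwa [Function.mem_support, angleFun, Set.indicator_of_mem hθ'] at hθ
  exact ⟨Circle.exp θ, subset_tsupport f this, Circle.arg_exp hθ'.1 hθ'.2.le⟩

theorem hasCompactSupport_angleFun {f : Circle → ℂ} (hf : (-1 : Circle) ∉ tsupport f) :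
    HasCompactSupport (angleFun f) :=
  (tsupport_angleFun_subset hf).2.of_isClosed_subset (isClosed_tsupport _)
    (tsupport_angleFun_subset hf).1

theorem tsupport_angleFun_subset_Ioo {f : Circle → ℂ} (hf : (-1 : Circle) ∉ tsupport f) :
    tsupport (angleFun f) ⊆ Set.Ioo (-Real.pi) Real.pi := by
  intro θ hθ
  obtain ⟨z, hz, rfl⟩ := (tsupport_angleFun_subset hf).1 hθ
  have h := mem_slitPlane_of_ne_neg_one (z := z) (fun h => hf (h ▸ hz))
  exact ⟨Complex.neg_pi_lt_arg _,
    lt_of_le_of_ne (Complex.arg_le_pi _) (Complex.mem_slitPlane_iff_arg.mp h).1⟩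

theorem contDiff_angleFun {f : Circle → ℂ} (hf : IsTestFunction f) :
    ContDiff ℝ ∞ (angleFun f) := by
  refine (contMDiff_of_tsupport fun θ hθ => ContDiffAt.contMDiffAt ?_).contDiff
  have h1 : ContDiff ℝ ∞ fun θ => f (Circle.exp θ) :=
    (hf.smooth.comp contMDiff_circleExp).contDiff
  refine h1.contDiffAt.congr_of_eventuallyEq ?_
  filter_upwards [isOpen_Ioo.mem_nhds (tsupport_angleFun_subset_Ioo hf.support hθ)] with x hx
  exact Set.indicator_of_mem hx _

theorem circleCoeff_eq_integral (f : Circle → ℂ) (s : ℝ) :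
    circleCoeff f s = (1 / (2 * Real.pi) : ℝ) *
      ∫ θ : ℝ, angleFun f θ * Complex.exp (-(Complex.I * s * θ)) := by
  rw [circleCoeff, intervalIntegral.integral_of_le (by linarith [Real.pi_pos]),
    MeasureTheory.integral_Ioc_eq_integral_Ioo,
    ← MeasureTheory.integral_indicator measurableSet_Ioo]
  congr 2
  ext θ
  simp only [angleFun, Set.indicator_apply, ite_mul, zero_mul]

theorem rapidDecay_of_schwartz (F : SchwartzMap ℝ ℂ) : RapidDecay F := by
  intro M
  obtain ⟨C0, -, h0⟩ := F.decay 0 0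
  obtain ⟨C1, -, h1⟩ := F.decay M 0
  refine ⟨2 ^ M * (C0 + C1), fun s => ?_⟩
  have h0 := h0 s
  have h1 := h1 s
  simp only [norm_iteratedFDeriv_zero, pow_zero, one_mul, Real.norm_eq_abs] at h0 h1
  have hb : (1 + |s|) ^ M ≤ 2 ^ M * (1 + |s| ^ M) := by
    calc (1 + |s|) ^ M ≤ (2 * max 1 |s|) ^ M := by
          gcongr
          linarith [le_max_left 1 |s|, le_max_right 1 |s|]
      _ = 2 ^ M * (max 1 |s|) ^ M := mul_pow ..
      _ ≤ _ := by
        gcongr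
        rcases max_choice 1 |s| with h | h <;> rw [h]
        · simp
        · simp
  calc ‖F s‖ * (1 + |s|) ^ M ≤ ‖F s‖ * (2 ^ M * (1 + |s| ^ M)) := by gcongr
    _ = 2 ^ M * (‖F s‖ + |s| ^ M * ‖F s‖) := by ring
    _ ≤ _ := by gcongr

theorem rapidDecay_circleCoeff {f : Circle → ℂ} (hf : IsTestFunction f) :
    RapidDecay (circleCoeff f) := by
  set F := (hasCompactSupport_angleFun hf.support).toSchwartzMap (contDiff_angleFun hf) with hF
  have key : ∀ s, circleCoeff f s =
      (1 / (2 * Real.pi) : ℝ) * FourierTransform.fourier F (s / (2 * Real.pi)) := by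
    intro s
    rw [circleCoeff_eq_integral, SchwartzMap.fourier_coe, Real.fourier_real_eq_integral_exp_smul]
    congr 2
    ext θ
    rw [smul_eq_mul, mul_comm]
    congr 2
    push_cast
    field_simp
  intro M
  obtain ⟨K, hK⟩ := rapidDecay_of_schwartz (FourierTransform.fourier F) M
  refine ⟨(2 * Real.pi) ^ M * K, fun s => ?_⟩
  have hpi : 1 ≤ 2 * Real.pi := by linarith [Real.pi_gt_three]
  have hpi0 : 0 < 2 * Real.pi := by linarith
  have h := hK (s / (2 * Real.pi))
  rw [key, norm_mul]
  have h1 : 1 + |s| ≤ 2 * Real.pi * (1 + |s / (2 * Real.pi)|) := by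
    rw [abs_div, abs_of_pos hpi0, mul_add, mul_div_cancel₀ _ hpi0.ne']
    linarith
  have h2 : ‖((1 / (2 * Real.pi) : ℝ) : ℂ)‖ ≤ 1 := by
    rw [Complex.norm_real, Real.norm_of_nonneg (by positivity), div_le_one hpi0]
    exact hpi
  calc _ ≤ 1 * ‖FourierTransform.fourier F (s / (2 * Real.pi))‖ *
        (2 * Real.pi * (1 + |s / (2 * Real.pi)|)) ^ M := by gcongr
    _ = (2 * Real.pi) ^ M * (‖FourierTransform.fourier F (s / (2 * Real.pi))‖ *
        (1 + |s / (2 * Real.pi)|) ^ M) := by rw [mul_pow]; ring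
    _ ≤ _ := by gcongr

theorem IsTestFunction.star {f : Circle → ℂ} (hf : IsTestFunction f) :
    IsTestFunction fun z => starRingEnd ℂ (f z) where
  smooth := (Complex.conjCLE.contDiff.contMDiff (n := ∞)).comp hf.smooth
  support := fun h => hf.support (closure_mono (fun z hz => by
    simpa [Function.mem_support] using hz) h)

theorem circleCoeff_star (f : Circle → ℂ) (s : ℝ) :
    circleCoeff (fun z => starRingEnd ℂ (f z)) s = starRingEnd ℂ (circleCoeff f (-s)) := by
  rw [circleCoeff, circleCoeff, map_mul, Complex.conj_ofReal]
  congr 1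
  rw [intervalIntegral.integral_of_le (by linarith [Real.pi_pos]),
    intervalIntegral.integral_of_le (by linarith [Real.pi_pos]), ← integral_conj]
  congr 1
  ext θ
  rw [map_mul, ← Complex.exp_conj]
  simp

/-! ### Commuting two smeared binomial factors -/

section BoundaryValue

open MeasureTheory

theorem RapidDecay.bounded {φ : ℝ → ℂ} (h : RapidDecay φ) : ∃ K : ℝ, ∀ s, ‖φ s‖ ≤ K := by
  obtain ⟨K, hK⟩ := h 0
  exact ⟨K, fun s => by simpa using hK s⟩

theorem summable_oneSubPowCoeff_mul {φ χ : ℝ → ℂ} (hφ : RapidDecay φ) (hχ : RapidDecay χ)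
    (β a b : ℝ) {σ : ℝ} (hσ : |σ| = 1) :
    Summable fun k : ℕ => (oneSubPowCoeff β k : ℂ) * (φ (a + σ * k) * χ (b - σ * k)) := by
  obtain ⟨M, hM⟩ := exists_abs_oneSubPowCoeff_le β
  obtain ⟨K, hK⟩ := hφ (M + 2)
  obtain ⟨K', hK'⟩ := hχ.bounded
  have hs : Summable fun k : ℕ => (1 + |a|) ^ (M + 2) * K * K' * (1 / ((k : ℝ) + 1) ^ 2) := by
    refine Summable.mul_left _ ?_
    exact_mod_cast (summable_nat_add_iff 1).mpr (Real.summable_one_div_nat_pow.mpr one_lt_two)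
  refine Summable.of_norm_bounded hs fun k => ?_
  have hk : (0 : ℝ) < k + 1 := by positivity
  have h1 : (k + 1 : ℝ) ≤ (1 + |a|) * (1 + |a + σ * k|) := by
    have h2 : (k : ℝ) = |σ * k| := by rw [abs_mul, hσ, one_mul, Nat.abs_cast]
    have h3 : |σ * k| ≤ |a + σ * k| + |a| := by
      have := abs_sub (a + σ * k) a
      rwa [add_sub_cancel_left] at this
    have := mul_nonneg (abs_nonneg a) (abs_nonneg (a + σ * k))
    nlinarith
  have h4 : (k + 1 : ℝ) ^ (M + 2) * ‖φ (a + σ * k)‖ ≤ (1 + |a|) ^ (M + 2) * K := by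
    calc _ ≤ ((1 + |a|) * (1 + |a + σ * k|)) ^ (M + 2) * ‖φ (a + σ * k)‖ := by gcongr
      _ = (1 + |a|) ^ (M + 2) * (‖φ (a + σ * k)‖ * (1 + |a + σ * k|) ^ (M + 2)) := by
        rw [mul_pow]; ring
      _ ≤ _ := by gcongr; exact hK _
  rw [norm_mul, norm_mul, Complex.norm_real, Real.norm_eq_abs]
  calc _ ≤ (k + 1 : ℝ) ^ M * (‖φ (a + σ * k)‖ * ‖χ (b - σ * k)‖) := by gcongr; exact hM k
    _ = (k + 1 : ℝ) ^ (M + 2) * ‖φ (a + σ * k)‖ * ‖χ (b - σ * k)‖ * (1 / ((k : ℝ) + 1) ^ 2) := by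
      rw [pow_add]
      field_simp
    _ ≤ (1 + |a|) ^ (M + 2) * K * K' * (1 / ((k : ℝ) + 1) ^ 2) := by
      have := (by positivity : 0 ≤ (k + 1 : ℝ) ^ (M + 2) * ‖φ (a + σ * k)‖).trans h4
      gcongr
      exact hK' _

/-- The integrand, on pairs of angles, whose integral is the product of the Fourier integrals of
`F` at `a` and of `H` at `b`. -/
def twoPoint (F H : ℝ → ℂ) (a b : ℝ) (p : ℝ × ℝ) : ℂ :=
  F p.1 * Complex.exp (-(Complex.I * a * p.1)) * (H p.2 * Complex.exp (-(Complex.I * b * p.2)))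

variable {F H : ℝ → ℂ}

theorem twoPoint_shift (a b v : ℝ) (p : ℝ × ℝ) :
    twoPoint F H (a + v) (b - v) p =
      twoPoint F H a b p * Complex.exp (v * (p.2 - p.1) * Complex.I) := by
  have h1 : Complex.exp (-(Complex.I * ((a + v : ℝ) : ℂ) * p.1)) =
      Complex.exp (-(Complex.I * a * p.1)) * Complex.exp (-(Complex.I * v * p.1)) := by
    rw [← Complex.exp_add]; congr 1; push_cast; ring
  have h2 : Complex.exp (-(Complex.I * ((b - v : ℝ) : ℂ) * p.2)) =
      Complex.exp (-(Complex.I * b * p.2)) * Complex.exp (Complex.I * v * p.2) := by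
    rw [← Complex.exp_add]; congr 1; push_cast; ring
  have h3 : Complex.exp (v * (p.2 - p.1) * Complex.I) =
      Complex.exp (-(Complex.I * v * p.1)) * Complex.exp (Complex.I * v * p.2) := by
    rw [← Complex.exp_add]; congr 1; ring
  rw [twoPoint, twoPoint, h1, h2, h3]
  ring

theorem norm_twoPoint (a b : ℝ) (p : ℝ × ℝ) : ‖twoPoint F H a b p‖ = ‖F p.1‖ * ‖H p.2‖ := by
  have h : ∀ u v : ℝ, ‖Complex.exp (-(Complex.I * u * v))‖ = 1 := fun u v => by
    rw [Complex.norm_exp]; simp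
  simp only [twoPoint, norm_mul, h, mul_one]

theorem continuous_twoPoint (hF : Continuous F) (hH : Continuous H) (a b : ℝ) :
    Continuous (twoPoint F H a b) := by
  unfold twoPoint; fun_prop

theorem integrable_norm_mul (hF : Continuous F) (hH : Continuous H)
    (hF' : HasCompactSupport F) (hH' : HasCompactSupport H) :
    Integrable fun p : ℝ × ℝ => ‖F p.1‖ * ‖H p.2‖ :=
  (hF.integrable_of_hasCompactSupport hF').norm.mul_prod
    (hH.integrable_of_hasCompactSupport hH').norm

theorem integrable_twoPoint (hF : Continuous F) (hH : Continuous H)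
    (hF' : HasCompactSupport F) (hH' : HasCompactSupport H) (a b : ℝ) :
    Integrable (twoPoint F H a b) :=
  (integrable_norm_mul hF hH hF' hH').mono' (continuous_twoPoint hF hH a b).aestronglyMeasurable
    (ae_of_all _ fun p => (norm_twoPoint a b p).le)

theorem integral_twoPoint (a b : ℝ) :
    ∫ p, twoPoint F H a b p =
      (∫ θ : ℝ, F θ * Complex.exp (-(Complex.I * a * θ))) *
        ∫ θ : ℝ, H θ * Complex.exp (-(Complex.I * b * θ)) :=
  integral_prod_mul (μ := volume) (ν := volume)
    (fun θ : ℝ => F θ * Complex.exp (-(Complex.I * a * θ)))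
    (fun θ : ℝ => H θ * Complex.exp (-(Complex.I * b * θ)))

theorem norm_mul_exp_I (r x : ℝ) : ‖(r : ℂ) * Complex.exp (x * Complex.I)‖ = |r| := by
  rw [norm_mul, Complex.norm_exp_ofReal_mul_I, mul_one, Complex.norm_real, Real.norm_eq_abs]

/-- Inside the unit disc the binomial series may be integrated term by term. -/
theorem tsum_twoPoint_of_lt (hF : Continuous F) (hH : Continuous H)
    (hF' : HasCompactSupport F) (hH' : HasCompactSupport H) (a b σ β : ℝ) {r : ℝ}
    (hr0 : 0 ≤ r) (hr : r < 1) :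
    ∑' k : ℕ, ((oneSubPowCoeff β k * r ^ k : ℝ) : ℂ) *
        ∫ p, twoPoint F H (a + σ * k) (b - σ * k) p =
      ∫ p, twoPoint F H a b p *
        (1 - r * Complex.exp ((σ * (p.2 - p.1) : ℝ) * Complex.I)) ^ (β : ℂ) := by
  have hsum : Summable fun k : ℕ => |oneSubPowCoeff β k| * r ^ k := by
    have := (hasSum_oneSubPowCoeff β (u := r) (by simpa [abs_of_nonneg hr0] using hr)).summable.norm
    simpa [abs_of_nonneg hr0] using this
  have hint := integrable_norm_mul hF hH hF' hH'
  have hterm : ∀ (k : ℕ) (p : ℝ × ℝ), ((oneSubPowCoeff β k * r ^ k : ℝ) : ℂ) *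
      twoPoint F H (a + σ * k) (b - σ * k) p = twoPoint F H a b p *
        ((oneSubPowCoeff β k : ℂ) *
          (r * Complex.exp ((σ * (p.2 - p.1) : ℝ) * Complex.I)) ^ k) := by
    intro k p
    rw [twoPoint_shift, mul_pow, ← Complex.exp_nat_mul]
    push_cast
    have : (σ : ℂ) * k * (p.2 - p.1) * Complex.I = k * (σ * (p.2 - p.1) * Complex.I) := by ring
    rw [this]
    ring
  calc _ = ∑' k : ℕ, ∫ p, ((oneSubPowCoeff β k * r ^ k : ℝ) : ℂ) *
        twoPoint F H (a + σ * k) (b - σ * k) p := by simp only [integral_const_mul]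
    _ = ∫ p, ∑' k : ℕ, ((oneSubPowCoeff β k * r ^ k : ℝ) : ℂ) *
        twoPoint F H (a + σ * k) (b - σ * k) p := by
      refine (integral_tsum_of_summable_integral_norm
        (fun k => (integrable_twoPoint hF hH hF' hH' _ _).const_mul _) ?_)
      simp only [norm_mul, norm_twoPoint, integral_const_mul, Complex.norm_real, Real.norm_eq_abs,
        abs_pow, abs_of_nonneg hr0]
      exact hsum.mul_right _
    _ = _ := by
      congr 1
      ext p
      simp only [hterm, tsum_mul_left]
      congr 1
      refine (hasSum_oneSubPowCoeff β ?_).tsum_eq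
      rwa [norm_mul_exp_I, abs_of_nonneg hr0]

/-- The expansion of `(1 - ζ) ^ β` may be integrated up to the unit circle, away from `ζ = 1`. -/
theorem tsum_twoPoint (hF : Continuous F) (hH : Continuous H)
    (hF' : HasCompactSupport F) (hH' : HasCompactSupport H) (a b β : ℝ) {σ : ℝ}
    (hσ : |σ| = 1)
    (hFH : ∀ θ ∈ tsupport F, ∀ η ∈ tsupport H, 0 < η - θ ∧ η - θ < 2 * Real.pi)
    (hsum : Summable fun k : ℕ => (oneSubPowCoeff β k : ℂ) *
      ∫ p, twoPoint F H (a + σ * k) (b - σ * k) p) :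
    ∑' k : ℕ, (oneSubPowCoeff β k : ℂ) * ∫ p, twoPoint F H (a + σ * k) (b - σ * k) p =
      ∫ p, twoPoint F H a b p *
        (1 - Complex.exp ((σ * (p.2 - p.1) : ℝ) * Complex.I)) ^ (β : ℂ) := by
  have hcos : ∀ p ∈ tsupport F ×ˢ tsupport H, Real.cos (σ * (p.2 - p.1)) < 1 := by
    rintro p ⟨h1, h2⟩
    have h := hFH _ h1 _ h2
    rcases abs_eq (zero_le_one' ℝ) |>.mp hσ with rfl | rfl
    · rw [one_mul]; exact cos_lt_one_of_mem h.1 h.2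
    · rw [neg_one_mul, Real.cos_neg]; exact cos_lt_one_of_mem h.1 h.2
  have hcont : ContinuousOn (fun q : ℝ × ℝ × ℝ =>
      (1 - (q.1 : ℂ) * Complex.exp ((σ * (q.2.2 - q.2.1) : ℝ) * Complex.I)) ^ (β : ℂ))
      (Set.Icc 0 1 ×ˢ (tsupport F ×ˢ tsupport H)) := by
    refine ContinuousOn.cpow_const (by fun_prop) fun q hq => ?_
    exact one_sub_smul_exp_mem_slitPlane hq.1.1 hq.1.2 (hcos _ hq.2)
  -- on the compact set where the integrand lives, `1 - r ζ` stays off the branch cut, so that its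
  -- power is bounded uniformly in `r`
  obtain ⟨C, hC⟩ :=
    (isCompact_Icc.prod (hF'.isCompact.prod hH'.isCompact)).exists_bound_of_continuousOn hcont
  have hmem : ∀ᶠ r : ℝ in 𝓝[<] 1, r ∈ Set.Ico (0 : ℝ) 1 := by
    filter_upwards [Ioo_mem_nhdsLT (zero_lt_one' ℝ)] with r hr using ⟨hr.1.le, hr.2⟩
  have hzero : ∀ p ∉ tsupport F ×ˢ tsupport H, twoPoint F H a b p = 0 := by
    intro p hp
    rw [Set.mem_prod, not_and_or] at hp
    rcases hp with hp | hp
    · simp [twoPoint, image_eq_zero_of_notMem_tsupport hp]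
    · simp [twoPoint, image_eq_zero_of_notMem_tsupport hp]
  have hL : Filter.Tendsto (fun r : ℝ => ∑' k : ℕ, ((oneSubPowCoeff β k * r ^ k : ℝ) : ℂ) *
      ∫ p, twoPoint F H (a + σ * k) (b - σ * k) p) (𝓝[<] 1)
      (𝓝 (∑' k : ℕ, (oneSubPowCoeff β k : ℂ) *
        ∫ p, twoPoint F H (a + σ * k) (b - σ * k) p)) := by
    refine tendsto_tsum_of_dominated_convergence hsum.norm (fun k => ?_) ?_
    · have : Continuous fun r : ℝ => ((oneSubPowCoeff β k * r ^ k : ℝ) : ℂ) *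
          ∫ p, twoPoint F H (a + σ * k) (b - σ * k) p := by fun_prop
      have := this.tendsto 1
      simp only [one_pow, mul_one] at this
      exact this.mono_left nhdsWithin_le_nhds
    · filter_upwards [hmem] with r hr k
      rw [norm_mul, norm_mul]
      gcongr
      rw [Complex.norm_real, Complex.norm_real, norm_mul, norm_pow, Real.norm_of_nonneg hr.1]
      exact mul_le_of_le_one_right (norm_nonneg _) (pow_le_one₀ hr.1 hr.2.le)
  have hR : Filter.Tendsto (fun r : ℝ => ∫ p, twoPoint F H a b p *
        (1 - r * Complex.exp ((σ * (p.2 - p.1) : ℝ) * Complex.I)) ^ (β : ℂ)) (𝓝[<] 1)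
      (𝓝 (∫ p, twoPoint F H a b p *
        (1 - Complex.exp ((σ * (p.2 - p.1) : ℝ) * Complex.I)) ^ (β : ℂ))) := by
    refine tendsto_integral_filter_of_dominated_convergence
      (fun p => ‖F p.1‖ * ‖H p.2‖ * C) ?_ ?_ ((integrable_norm_mul hF hH hF' hH').mul_const C) ?_
    · refine Filter.Eventually.of_forall fun r => ?_
      refine (continuous_twoPoint hF hH a b).aestronglyMeasurable.mul ?_
      refine Measurable.aestronglyMeasurable ?_
      fun_prop
    · filter_upwards [hmem] with r hr
      refine ae_of_all _ fun p => ?_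
      by_cases hp : p ∈ tsupport F ×ˢ tsupport H
      · rw [norm_mul, norm_twoPoint]
        gcongr
        exact hC (r, p) ⟨⟨hr.1, hr.2.le⟩, hp⟩
      · rw [hzero p hp, zero_mul, norm_zero, ← norm_twoPoint a b, hzero p hp]
        simp
    · refine ae_of_all _ fun p => ?_
      by_cases hp : p ∈ tsupport F ×ˢ tsupport H
      · refine Filter.Tendsto.const_mul _ ?_
        have := one_sub_smul_exp_mem_slitPlane zero_le_one le_rfl (hcos p hp)
        have hc : ContinuousAt (fun r : ℝ =>
            (1 - (r : ℂ) * Complex.exp ((σ * (p.2 - p.1) : ℝ) * Complex.I)) ^ (β : ℂ)) 1 :=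
          ContinuousAt.cpow (by fun_prop) continuousAt_const this
        have := hc.tendsto
        simp only [Complex.ofReal_one, one_mul] at this
        exact this.mono_left nhdsWithin_le_nhds
      · simp only [hzero p hp, zero_mul]
        exact tendsto_const_nhds
  refine tendsto_nhds_unique hL (hR.congr' ?_)
  filter_upwards [hmem] with r hr
  exact (tsum_twoPoint_of_lt hF hH hF' hH' a b σ β hr.1 hr.2).symm

end BoundaryValue

/-- The two expansions, in `|z| < |w|` and in `|w| < |z|`, of `w ^ (-a) * z ^ (-b)` times the
`(-α)`-th power of `1 - z / w`, resp. `1 - w / z`, agree up to the phase `e^{iπα}` when smeared with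
test functions whose supports are ordered by the angle. -/
theorem tsum_circleCoeff_mul_circleCoeff {f g : Circle → ℂ} (hf : IsTestFunction f)
    (hg : IsTestFunction g)
    (hfg : ∀ w ∈ tsupport f, ∀ z ∈ tsupport g, Complex.arg w < Complex.arg z) (α a b : ℝ) :
    ∑' k : ℕ, (oneSubPowCoeff (-α) k : ℂ) * (circleCoeff f (a + k) * circleCoeff g (b - k)) =
      Complex.exp (α * Real.pi * Complex.I) * ∑' k : ℕ, (oneSubPowCoeff (-α) k : ℂ) *
        (circleCoeff f (a - α - k) * circleCoeff g (b + α + k)) := by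
  have hF := (contDiff_angleFun hf).continuous
  have hH := (contDiff_angleFun hg).continuous
  have hF' := hasCompactSupport_angleFun hf.support
  have hH' := hasCompactSupport_angleFun hg.support
  have hFH : ∀ θ ∈ tsupport (angleFun f), ∀ η ∈ tsupport (angleFun g),
      0 < η - θ ∧ η - θ < 2 * Real.pi := by
    intro θ hθ η hη
    have h1 := tsupport_angleFun_subset_Ioo hf.support hθ
    have h2 := tsupport_angleFun_subset_Ioo hg.support hη
    obtain ⟨w, hw, rfl⟩ := (tsupport_angleFun_subset hf.support).1 hθ
    obtain ⟨z, hz, rfl⟩ := (tsupport_angleFun_subset hg.support).1 hη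
    have := hfg w hw z hz
    simp only [Set.mem_Ioo] at h1 h2
    constructor <;> linarith
  have hprod : ∀ u v : ℝ, circleCoeff f u * circleCoeff g v =
      ((1 / (2 * Real.pi) : ℝ) : ℂ) ^ 2 * ∫ p, twoPoint (angleFun f) (angleFun g) u v p := by
    intro u v
    rw [circleCoeff_eq_integral, circleCoeff_eq_integral, integral_twoPoint]
    ring
  have hpi : ((1 / (2 * Real.pi) : ℝ) : ℂ) ^ 2 ≠ 0 := by
    simp [Real.pi_ne_zero]
  have main : ∀ a b σ : ℝ, |σ| = 1 →
      ∑' k : ℕ, (oneSubPowCoeff (-α) k : ℂ) *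
        (circleCoeff f (a + σ * k) * circleCoeff g (b - σ * k)) =
      ((1 / (2 * Real.pi) : ℝ) : ℂ) ^ 2 * ∫ p, twoPoint (angleFun f) (angleFun g) a b p *
        (1 - Complex.exp ((σ * (p.2 - p.1) : ℝ) * Complex.I)) ^ ((-α : ℝ) : ℂ) := by
    intro a b σ hσ
    have hs := summable_oneSubPowCoeff_mul (rapidDecay_circleCoeff hf) (rapidDecay_circleCoeff hg)
      (-α) a b hσ
    have he : ∀ k : ℕ, (oneSubPowCoeff (-α) k : ℂ) *
        (circleCoeff f (a + σ * k) * circleCoeff g (b - σ * k)) =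
        ((1 / (2 * Real.pi) : ℝ) : ℂ) ^ 2 * ((oneSubPowCoeff (-α) k : ℂ) *
          ∫ p, twoPoint (angleFun f) (angleFun g) (a + σ * k) (b - σ * k) p) := by
      intro k; rw [hprod]; ring
    simp only [he] at hs ⊢
    rw [tsum_mul_left, tsum_twoPoint hF hH hF' hH' a b (-α) hσ hFH
      ((summable_mul_left_iff hpi).mp hs)]
  have h1 := main a b 1 (by simp)
  have h2 := main (a - α) (b + α) (-1) (by simp)
  simp only [one_mul, neg_one_mul, sub_neg_eq_add, ← sub_eq_add_neg] at h1 h2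
  rw [h1, h2, mul_left_comm]
  congr 1
  rw [← MeasureTheory.integral_const_mul]
  congr 1
  ext p
  by_cases hp : p.1 ∈ tsupport (angleFun f) ∧ p.2 ∈ tsupport (angleFun g)
  · have h := hFH _ hp.1 _ hp.2
    have e1 := twoPoint_shift (F := angleFun f) (H := angleFun g) a b (-α) p
    rw [← sub_eq_add_neg, sub_neg_eq_add] at e1
    rw [one_sub_exp_cpow_eq h.1 h.2, e1]
    have e2 : Complex.exp (((-α : ℝ) : ℂ) * (((p.2 - p.1 : ℝ) : ℂ) - Real.pi) * Complex.I) =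
        Complex.exp (α * Real.pi * Complex.I) *
          Complex.exp (((-α : ℝ) : ℂ) * (p.2 - p.1) * Complex.I) := by
      rw [← Complex.exp_add]; congr 1; push_cast; ring
    rw [e2]
    have e3 : ((-(p.2 - p.1) : ℝ) : ℂ) * Complex.I = -(((p.2 - p.1 : ℝ) : ℂ) * Complex.I) := by
      push_cast; ring
    rw [e3]
    ring
  · have hz : ∀ u v, twoPoint (angleFun f) (angleFun g) u v p = 0 := by
      intro u v
      rw [not_and_or] at hp
      rcases hp with hp | hp
      · simp [twoPoint, image_eq_zero_of_notMem_tsupport hp]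
      · simp [twoPoint, image_eq_zero_of_notMem_tsupport hp]
    simp [hz]

/-! ### Scalar braiding relations -/

/-- A function of a real mode number that vanishes off `t - ℕ`. -/
def SupportedBelow (t : ℝ) (c : ℝ → ℂ) : Prop := ∀ s, c s ≠ 0 → ∃ n : ℕ, s = t - n

/-- The coefficients of the product of `(1 - u) ^ β` with the series of coefficients `c`. -/
def binomialConv (β : ℝ) (c : ℝ → ℂ) (m : ℝ) : ℂ := ∑' n : ℕ, (oneSubPowCoeff β n : ℂ) * c (m + n)

theorem SupportedBelow.finite_support {t : ℝ} {c : ℝ → ℂ} (hc : SupportedBelow t c) (m : ℝ) :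
    (Function.support fun n : ℕ => c (m + n)).Finite := by
  refine (Set.finite_le_nat ⌈t - m⌉₊).subset fun n hn => ?_
  obtain ⟨k, hk⟩ := hc _ hn
  have : (n : ℝ) ≤ t - m := by linarith [k.cast_nonneg (α := ℝ)]
  exact_mod_cast this.trans (Nat.le_ceil _)

theorem SupportedBelow.binomialConv {t : ℝ} {c : ℝ → ℂ} (hc : SupportedBelow t c) (β : ℝ) :
    SupportedBelow t (binomialConv β c) := by
  intro s hs
  have : ∃ n : ℕ, c (s + n) ≠ 0 := by
    by_contra! h
    exact hs (by simp [_root_.binomialConv, h])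
  obtain ⟨n, hn⟩ := this
  obtain ⟨k, hk⟩ := hc _ hn
  exact ⟨k + n, by push_cast; linarith⟩

theorem binomialConv_neg_binomialConv {t : ℝ} {c : ℝ → ℂ} (hc : SupportedBelow t c) (β s : ℝ) :
    binomialConv (-β) (binomialConv β c) s = c s := by
  have hfin : (Function.support fun q : ℕ × ℕ => (oneSubPowCoeff (-β) q.1 : ℂ) *
      ((oneSubPowCoeff β q.2 : ℂ) * c (s + q.1 + q.2))).Finite := by
    obtain ⟨B, hB⟩ := (hc.finite_support s).bddAbove
    refine ((Set.finite_le_nat B).prod (Set.finite_le_nat B)).subset fun q hq => ?_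
    have hq' : c (s + ((q.1 + q.2 : ℕ) : ℝ)) ≠ 0 := by
      have := right_ne_zero_of_mul (right_ne_zero_of_mul hq)
      push_cast
      rwa [← add_assoc]
    have : q.1 + q.2 ≤ B := hB hq'
    exact ⟨by simp; omega, by simp; omega⟩
  have hs : Summable fun q : ℕ × ℕ => (oneSubPowCoeff (-β) q.1 : ℂ) *
      ((oneSubPowCoeff β q.2 : ℂ) * c (s + q.1 + q.2)) := summable_of_hasFiniteSupport hfin
  calc _ = ∑' n : ℕ, ∑' k : ℕ, (oneSubPowCoeff (-β) n : ℂ) *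
        ((oneSubPowCoeff β k : ℂ) * c (s + n + k)) := by
        simp only [binomialConv, tsum_mul_left]
    _ = ∑' q : ℕ × ℕ, (oneSubPowCoeff (-β) q.1 : ℂ) *
        ((oneSubPowCoeff β q.2 : ℂ) * c (s + q.1 + q.2)) := hs.tsum_prod.symm
    _ = ∑' n : ℕ, ∑ q ∈ Finset.HasAntidiagonal.antidiagonal n, (oneSubPowCoeff (-β) q.1 : ℂ) *
        ((oneSubPowCoeff β q.2 : ℂ) * c (s + q.1 + q.2)) := by
      rw [← Finset.HasAntidiagonal.sigmaAntidiagonalEquivProd.tsum_eq]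
      refine (Summable.tsum_sigma' (fun n => (hasSum_fintype _).summable)
        (Finset.HasAntidiagonal.sigmaAntidiagonalEquivProd.summable_iff.mpr hs)).trans
        (tsum_congr fun n => ?_)
      rw [tsum_fintype]
      exact Finset.sum_coe_sort (Finset.HasAntidiagonal.antidiagonal n)
        fun q : ℕ × ℕ => (oneSubPowCoeff (-β) q.1 : ℂ) *
          ((oneSubPowCoeff β q.2 : ℂ) * c (s + q.1 + q.2))
    _ = ∑' n : ℕ, ((if n = 0 then 1 else 0 : ℝ) : ℂ) * c (s + n) := by
      refine tsum_congr fun n => ?_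
      rw [← sum_antidiagonal_oneSubPowCoeff_neg β n, Complex.ofReal_sum, Finset.sum_mul]
      refine Finset.sum_congr rfl fun q hq => ?_
      rw [← Finset.HasAntidiagonal.mem_antidiagonal.mp hq]
      push_cast
      rw [add_assoc]
      ring
    _ = c s := by
      rw [tsum_eq_single 0 (fun n hn => by simp [hn])]
      simp

/-- Pairing the product of `(1 - u) ^ β` with a series `e` with finitely many terms amounts to
pairing the terms of `e` with the product. -/
theorem tsum_mul_binomialConv {e : ℝ → ℂ} (he : e.support.Finite) (β : ℝ) (q : ℝ → ℂ)
    (hq : ∀ m : ℝ, Summable fun n : ℕ => (oneSubPowCoeff β n : ℂ) * q (m - n)) :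
    ∑' s : ℝ, q s * binomialConv β e s =
      ∑' m : ℝ, e m * ∑' n : ℕ, (oneSubPowCoeff β n : ℂ) * q (m - n) := by
  let shear : ℝ × ℕ ≃ ℝ × ℕ :=
    { toFun := fun p => (p.1 - p.2, p.2)
      invFun := fun p => (p.1 + p.2, p.2)
      left_inv := fun p => by simp
      right_inv := fun p => by simp }
  have hs : Summable fun p : ℝ × ℕ => e p.1 * ((oneSubPowCoeff β p.2 : ℂ) * q (p.1 - p.2)) := by
    refine Summable.of_norm ((summable_prod_of_nonneg fun p => norm_nonneg _).mpr ⟨fun m => ?_, ?_⟩)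
    · exact ((hq m).mul_left (e m)).norm
    · refine summable_of_hasFiniteSupport (he.subset fun m hm => ?_)
      rw [Function.mem_support] at hm ⊢
      contrapose! hm
      simp [hm]
  have hs' : Summable fun p : ℝ × ℕ =>
      q p.1 * ((oneSubPowCoeff β p.2 : ℂ) * e (p.1 + p.2)) := by
    rw [← shear.summable_iff]
    refine hs.congr fun p => ?_
    simp only [shear, Function.comp_apply, Equiv.coe_fn_mk, sub_add_cancel]
    ring
  calc _ = ∑' s : ℝ, ∑' n : ℕ, q s * ((oneSubPowCoeff β n : ℂ) * e (s + n)) := by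
        simp only [binomialConv, tsum_mul_left]
    _ = ∑' p : ℝ × ℕ, q p.1 * ((oneSubPowCoeff β p.2 : ℂ) * e (p.1 + p.2)) := hs'.tsum_prod.symm
    _ = ∑' p : ℝ × ℕ, e p.1 * ((oneSubPowCoeff β p.2 : ℂ) * q (p.1 - p.2)) := by
      rw [← shear.tsum_eq]
      refine tsum_congr fun p => ?_
      simp only [shear, Equiv.coe_fn_mk, sub_add_cancel]
      ring
    _ = _ := by
      rw [hs.tsum_prod]
      simp only [tsum_mul_left]

/-- Matrix elements `c`, `c'` of the two products of fields that satisfy the braiding relation give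
the same smeared matrix elements up to the phase: both products with the `α`-th power are the same
finite series `e`, so that `c`, `c'` are the two expansions of `e` times the `(-α)`-th power. -/
theorem tsum_circleCoeff_eq_of_braiding {f g : Circle → ℂ} (hf : IsTestFunction f)
    (hg : IsTestFunction g)
    (hfg : ∀ w ∈ tsupport f, ∀ z ∈ tsupport g, Complex.arg w < Complex.arg z)
    {α N t t' : ℝ} {c c' : ℝ → ℂ} (hc : SupportedBelow t c) (hc' : SupportedBelow t' c')
    (h : ∀ m, binomialConv α c m = binomialConv α c' (N - α - m)) :
    ∑' s : ℝ, circleCoeff f (N - s) * circleCoeff g s * c s =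
      Complex.exp (α * Real.pi * Complex.I) *
        ∑' s : ℝ, circleCoeff f s * circleCoeff g (N - s) * c' s := by
  set e := binomialConv α c with he_def
  set e' := binomialConv α c' with he'_def
  have he : e.support.Finite := by
    obtain ⟨B, hB⟩ := exists_nat_ge (t + t' - N + α)
    refine ((Set.finite_le_nat B).image fun n : ℕ => t - n).subset fun m hm => ?_
    obtain ⟨n, hn⟩ := hc.binomialConv α m hm
    obtain ⟨n', hn'⟩ := hc'.binomialConv α (N - α - m) (by
      rw [← he'_def, ← h]; exact hm)
    refine ⟨n, ?_, hn.symm⟩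
    have : (n : ℝ) ≤ B := by linarith [n'.cast_nonneg (α := ℝ)]
    exact_mod_cast this
  have he' : e'.support.Finite := by
    refine (he.image fun m => N - α - m).subset fun m hm => ⟨N - α - m, ?_, by simp⟩
    have := h (N - α - m)
    rw [sub_sub_cancel] at this
    rw [Function.mem_support, this]; exact hm
  have hrf := rapidDecay_circleCoeff hf
  have hrg := rapidDecay_circleCoeff hg
  have h1 : ∑' s : ℝ, circleCoeff f (N - s) * circleCoeff g s * c s =
      ∑' m : ℝ, e m * ∑' n : ℕ, (oneSubPowCoeff (-α) n : ℂ) *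
        (circleCoeff f (N - m + n) * circleCoeff g (m - n)) := by
    have := tsum_mul_binomialConv he (-α) (fun s => circleCoeff f (N - s) * circleCoeff g s)
      (fun m => by
        refine (summable_oneSubPowCoeff_mul hrf hrg (-α) (N - m) m (σ := 1) (by simp)).congr
          fun n => ?_
        rw [one_mul, sub_add])
    simp only [sub_sub_eq_add_sub, binomialConv_neg_binomialConv hc, he_def] at this
    rw [this]
    refine tsum_congr fun m => ?_
    simp only [sub_add_eq_add_sub, he_def]
  have h2 : ∑' s : ℝ, circleCoeff f s * circleCoeff g (N - s) * c' s =
      ∑' m : ℝ, e' m * ∑' n : ℕ, (oneSubPowCoeff (-α) n : ℂ) *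
        (circleCoeff f (m - n) * circleCoeff g (N - m + n)) := by
    have := tsum_mul_binomialConv he' (-α) (fun s => circleCoeff f s * circleCoeff g (N - s))
      (fun m => by
        refine (summable_oneSubPowCoeff_mul hrf hrg (-α) m (N - m) (σ := -1) (by simp)).congr
          fun n => ?_
        congr 3 <;> ring)
    simp only [sub_sub_eq_add_sub, binomialConv_neg_binomialConv hc', he'_def] at this
    rw [this]
    refine tsum_congr fun m => ?_
    simp only [sub_add_eq_add_sub, he'_def]
  rw [h1, h2, ← (Equiv.subLeft (N - α)).tsum_eq, ← tsum_mul_left]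
  refine tsum_congr fun m => ?_
  have hem : e (N - α - m) = e' m := by rw [h, sub_sub_cancel]
  rw [Equiv.subLeft_apply, hem, tsum_circleCoeff_mul_circleCoeff hf hg hfg, mul_left_comm]
  congr 3
  ext n
  congr 3 <;> ring

/-! ### Decomposition into vectors of definite charge and energy -/

namespace EnergyGrading

variable {G : Type*} {𝓗 : Type*} [NormedAddCommGroup 𝓗] [InnerProductSpace ℂ 𝓗]
  [CompleteSpace 𝓗] (S : EnergyGrading G 𝓗)

theorem L₀_symmetric (x y : S.L₀.domain) : ⟪S.L₀ x, (y : 𝓗)⟫_ℂ = ⟪(x : 𝓗), S.L₀ y⟫_ℂ := by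
  have h := LinearPMap.adjoint_isFormalAdjoint S.isSelfAdjoint_L₀.dense_domain
  rw [LinearPMap.isSelfAdjoint_def.mp S.isSelfAdjoint_L₀] at h
  exact h x y

theorem eigenSubspace_orthogonal {t u : ℝ} (htu : t ≠ u) {x y : 𝓗}
    (hx : x ∈ eigenSubspace S.L₀ t) (hy : y ∈ eigenSubspace S.L₀ u) : ⟪x, y⟫_ℂ = 0 := by
  obtain ⟨hx', hx⟩ := mem_eigenSubspace.mp hx
  obtain ⟨hy', hy⟩ := mem_eigenSubspace.mp hy
  have h := S.L₀_symmetric ⟨x, hx'⟩ ⟨y, hy'⟩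
  rw [hx, hy, inner_smul_left, inner_smul_right, Complex.conj_ofReal, ← sub_eq_zero,
    ← sub_mul] at h
  refine (mul_eq_zero.mp h).resolve_left ?_
  exact_mod_cast sub_ne_zero.mpr htu

theorem homog_inner_eq_zero {i j : G × ℝ} (hij : i ≠ j) {x y : 𝓗} (hx : x ∈ S.homog i.1 i.2)
    (hy : y ∈ S.homog j.1 j.2) : ⟪x, y⟫_ℂ = 0 := by
  by_cases h : i.1 = j.1
  · exact S.eigenSubspace_orthogonal (fun h' => hij (Prod.ext h h')) hx.2 hy.2
  · exact (S.sector_orthogonal _ _ h).inner_eq hx.1 hy.1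

theorem orthogonalFamily_homog : OrthogonalFamily ℂ (fun i : G × ℝ => S.homog i.1 i.2)
    fun i => (S.homog i.1 i.2).subtypeₗᵢ :=
  fun _ _ hij x y => S.homog_inner_eq_zero hij x.2 y.2

theorem sector_le_closure_iSup_homog (g : G) :
    S.sector g ≤ (⨆ i : G × ℝ, S.homog i.1 i.2).topologicalClosure := by
  rw [← S.spectrum_sector g]
  exact Submodule.topologicalClosure_mono
    (iSup_le fun n => le_iSup (fun i : G × ℝ => S.homog i.1 i.2) (g, S.lowestEnergy g + n))

theorem closure_iSup_homog : (⨆ i : G × ℝ, S.homog i.1 i.2).topologicalClosure = ⊤ := by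
  rw [eq_top_iff, ← S.dense_sector]
  exact Submodule.topologicalClosure_minimal _ (iSup_le S.sector_le_closure_iSup_homog)
    (Submodule.isClosed_topologicalClosure _)

/-- Only the energies `lowestEnergy g + n` occur for the charge `g`. -/
theorem exists_energy_eq {g : G} {t : ℝ} {x : 𝓗} (hx : x ∈ S.homog g t) (hx0 : x ≠ 0) :
    ∃ n : ℕ, t = S.lowestEnergy g + n := by
  by_contra! h
  refine hx0 (inner_self_eq_zero (𝕜 := ℂ).mp ?_)
  have h1 : (⨆ n : ℕ, S.sector g ⊓ eigenSubspace S.L₀ (S.lowestEnergy g + n)) ≤ (ℂ ∙ x)ᗮ := by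
    refine iSup_le fun n y hy => ?_
    rw [Submodule.mem_orthogonal_singleton_iff_inner_right]
    exact S.eigenSubspace_orthogonal (h n) hx.2 hy.2
  have h2 := Submodule.topologicalClosure_minimal _ h1 (Submodule.isClosed_orthogonal _)
  rw [S.spectrum_sector g] at h2
  exact (Submodule.mem_orthogonal_singleton_iff_inner_right.mp (h2 hx.1))

theorem energy_nonneg {g : G} {t : ℝ} {x : 𝓗} (hx : x ∈ S.homog g t) (hx0 : x ≠ 0) : 0 ≤ t := by
  obtain ⟨n, rfl⟩ := S.exists_energy_eq hx hx0
  have := S.lowestEnergy_nonneg g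
  positivity

theorem proj_mem (i : G × ℝ) (Ψ : 𝓗) : (S.proj i Ψ : 𝓗) ∈ S.homog i.1 i.2 :=
  ((S.homog i.1 i.2).orthogonalProjectionOnto Ψ).2

theorem coe_proj (i : G × ℝ) (Ψ : 𝓗) :
    (S.proj i Ψ : 𝓗) = (S.homog i.1 i.2).orthogonalProjectionOnto Ψ := rfl

theorem proj_nonneg_of_ne {i : G × ℝ} {Ψ : 𝓗} (h : S.proj i Ψ ≠ 0) : 0 ≤ i.2 :=
  S.energy_nonneg (S.proj_mem i Ψ) (by simpa using h)

theorem proj_of_mem {i : G × ℝ} {x : 𝓗} (hx : x ∈ S.homog i.1 i.2) : (S.proj i x : 𝓗) = x := by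
  rw [coe_proj, Submodule.orthogonalProjectionOnto_mem_subspace_eq_self ⟨x, hx⟩]

theorem proj_of_mem_of_ne {i j : G × ℝ} (hij : i ≠ j) {x : 𝓗} (hx : x ∈ S.homog j.1 j.2) :
    S.proj i x = 0 := by
  apply Subtype.ext
  rw [coe_proj, Submodule.orthogonalProjectionOnto_apply_of_mem_orthogonal]
  · rfl
  · exact fun y hy => S.homog_inner_eq_zero hij hy hx

/-- Every vector is the sum of its components of definite charge and energy. -/
theorem hasSum_proj (Ψ : 𝓗) : HasSum (fun i : G × ℝ => (S.proj i Ψ : 𝓗)) Ψ := by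
  have hV : IsHilbertSum ℂ (fun i : G × ℝ => S.homog i.1 i.2)
      fun i => (S.homog i.1 i.2).subtypeₗᵢ :=
    IsHilbertSum.mkInternal _ S.orthogonalFamily_homog S.closure_iSup_homog.ge
  have h := hV.hasSum_linearIsometryEquiv_symm (hV.linearIsometryEquiv Ψ)
  rw [LinearIsometryEquiv.symm_apply_apply] at h
  have key : ∀ j, (hV.linearIsometryEquiv Ψ j : 𝓗) = S.proj j Ψ := by
    intro j
    have h1 := h.mapL (S.homog j.1 j.2).orthogonalProjectionOnto
    have h2 := hasSum_single (f := fun i => (S.homog j.1 j.2).orthogonalProjectionOnto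
      ((S.homog i.1 i.2).subtypeₗᵢ (hV.linearIsometryEquiv Ψ i))) j (fun i hi => by
        apply Submodule.orthogonalProjectionOnto_apply_of_mem_orthogonal
        exact fun y hy => S.homog_inner_eq_zero hi.symm hy (hV.linearIsometryEquiv Ψ i).2)
    have h3 := h2.unique h1
    rw [coe_proj, ← h3]
    simp
  simpa [key] using h

theorem summable_iff_norm_sq {v : G × ℝ → 𝓗} (hv : ∀ i, v i ∈ S.homog i.1 i.2) :
    Summable v ↔ Summable fun i => ‖v i‖ ^ 2 := by
  have := S.orthogonalFamily_homog.summable_iff_norm_sq_summable fun i => ⟨v i, hv i⟩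
  simpa using this

theorem proj_sum {ι : Type*} {v : ι → 𝓗} {Φ : 𝓗} (h : HasSum v Φ) (i : G × ℝ) :
    HasSum (fun k => (S.proj i (v k) : 𝓗)) (S.proj i Φ) :=
  h.mapL ((S.homog i.1 i.2).subtypeL ∘L (S.homog i.1 i.2).orthogonalProjectionOnto)

theorem proj_smul (i : G × ℝ) (a : ℂ) (Ψ : 𝓗) : S.proj i (a • Ψ) = a • S.proj i Ψ := by
  apply Subtype.ext; simp [coe_proj]

theorem inner_proj (i : G × ℝ) {y : 𝓗} (hy : y ∈ S.homog i.1 i.2) (Ψ : 𝓗) :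
    ⟪y, (S.proj i Ψ : 𝓗)⟫_ℂ = ⟪y, Ψ⟫_ℂ :=
  Submodule.inner_orthogonalProjectionOnto_eq_of_mem_left (K := S.homog i.1 i.2) ⟨y, hy⟩ Ψ

theorem eq_of_inner_homog {Φ Φ' : 𝓗} (h : ∀ (i : G × ℝ), ∀ y ∈ S.homog i.1 i.2,
    ⟪y, Φ⟫_ℂ = ⟪y, Φ'⟫_ℂ) : Φ = Φ' := by
  refine (S.hasSum_proj Φ).unique ?_
  convert! S.hasSum_proj Φ' using 2 with i
  have key : (S.homog i.1 i.2).orthogonalProjectionOnto Φ =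
      (S.homog i.1 i.2).orthogonalProjectionOnto Φ' := by
    refine ext_inner_left ℂ fun y => ?_
    have := h i y y.2
    rwa [← S.inner_proj i y.2, ← S.inner_proj i y.2 Φ'] at this
  rw [coe_proj, coe_proj, key]

/-! ### Smooth vectors -/

theorem mem_L₀_domain_of_homog {i : G × ℝ} {x : 𝓗} (hx : x ∈ S.homog i.1 i.2) :
    ∃ h : x ∈ S.L₀.domain, S.L₀ ⟨x, h⟩ = (i.2 : ℂ) • x := mem_eigenSubspace.mp hx.2

theorem proj_L₀ (x : S.L₀.domain) (i : G × ℝ) : S.proj i (S.L₀ x) = (i.2 : ℂ) • S.proj i x := by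
  suffices key : (S.homog i.1 i.2).orthogonalProjectionOnto (S.L₀ x) =
      (i.2 : ℂ) • (S.homog i.1 i.2).orthogonalProjectionOnto (x : 𝓗) by
    apply Subtype.ext
    rw [Submodule.coe_smul, coe_proj, coe_proj, key, Submodule.coe_smul]
  refine ext_inner_left ℂ fun y => ?_
  obtain ⟨hy, hy'⟩ := S.mem_L₀_domain_of_homog y.2
  have h1 := S.L₀_symmetric ⟨y, hy⟩ x
  rw [hy', inner_smul_left, Complex.conj_ofReal] at h1
  have h2 := S.inner_proj i y.2 (S.L₀ x)
  have h3 := S.inner_proj i y.2 x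
  rw [inner_smul_right]
  simp only [coe_proj, ← Submodule.coe_inner] at h2 h3
  rw [h2, h3, ← h1]

/-- The domain of `L₀` in terms of components. As `L₀` is closed, `Ψ` belongs to the domain once the
values of `L₀` on the components of `Ψ` are summable. -/
theorem mem_L₀_domain_iff {Ψ : 𝓗} : Ψ ∈ S.L₀.domain ↔
    Summable fun i : G × ℝ => ‖((i.2 : ℝ) : ℂ) • (S.proj i Ψ : 𝓗)‖ ^ 2 := by
  rw [← S.summable_iff_norm_sq fun i => Submodule.smul_mem _ _ (S.proj_mem i Ψ)]
  constructor
  · intro h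
    have := (S.hasSum_proj (S.L₀ ⟨Ψ, h⟩)).summable
    simpa [S.proj_L₀] using this
  · rintro ⟨Φ, hΦ⟩
    have hcl : IsClosed (S.L₀.graph : Set (𝓗 × 𝓗)) := S.isSelfAdjoint_L₀.isClosed
    have hmem : (Ψ, Φ) ∈ S.L₀.graph := by
      refine hcl.mem_of_tendsto ((S.hasSum_proj Ψ).prodMk hΦ)
        (Filter.Eventually.of_forall fun F => ?_)
      refine Submodule.sum_mem _ fun i _ => ?_
      obtain ⟨h, h'⟩ := S.mem_L₀_domain_of_homog (S.proj_mem i Ψ)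
      exact (LinearPMap.mem_graph_iff _).mpr ⟨⟨_, h⟩, rfl, h'⟩
    obtain ⟨y, hy, -⟩ := (LinearPMap.mem_graph_iff _).mp hmem
    have hy : (y : 𝓗) = Ψ := hy
    exact hy ▸ y.2

theorem mem_powDomain_succ {l : ℕ} {Ψ : 𝓗} : Ψ ∈ powDomain S.L₀ (l + 1) ↔
    ∃ h : Ψ ∈ S.L₀.domain, S.L₀ ⟨Ψ, h⟩ ∈ powDomain S.L₀ l := by
  constructor
  · rintro ⟨y, hy, rfl⟩; exact ⟨y.2, hy⟩
  · rintro ⟨h, h'⟩; exact ⟨⟨Ψ, h⟩, h', rfl⟩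

theorem powDomain_succ_le (l : ℕ) : powDomain S.L₀ (l + 1) ≤ powDomain S.L₀ l := by
  induction l with
  | zero => exact fun _ _ => Submodule.mem_top
  | succ l ih =>
    intro Ψ hΨ
    obtain ⟨h, h'⟩ := S.mem_powDomain_succ.mp hΨ
    exact S.mem_powDomain_succ.mpr ⟨h, ih h'⟩

/-- The components of `Ψ` are square summable with the weight `(1 + t) ^ l`, where `t` is the
energy; this characterizes the domain of the `l`-th power of `L₀`. -/
def WeightSummable (l : ℕ) (Ψ : 𝓗) : Prop :=
  Summable fun i : G × ℝ => ((1 + i.2) ^ l * ‖(S.proj i Ψ : 𝓗)‖) ^ 2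

theorem weight_nonneg (l : ℕ) (i : G × ℝ) (Ψ : 𝓗) : 0 ≤ (1 + i.2) ^ l * ‖(S.proj i Ψ : 𝓗)‖ := by
  by_cases h : S.proj i Ψ = 0
  · simp [h]
  · have := S.proj_nonneg_of_ne h
    positivity

theorem weightSummable_zero (Ψ : 𝓗) : S.WeightSummable 0 Ψ := by
  have := (S.summable_iff_norm_sq fun i => S.proj_mem i Ψ).mp (S.hasSum_proj Ψ).summable
  simpa [WeightSummable] using this

theorem weightSummable_mono {l m : ℕ} (hlm : l ≤ m) {Ψ : 𝓗} (h : S.WeightSummable m Ψ) :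
    S.WeightSummable l Ψ := by
  refine Summable.of_nonneg_of_le (fun i => sq_nonneg _) (fun i => ?_) h
  by_cases hi : S.proj i Ψ = 0
  · simp [hi]
  · have := S.proj_nonneg_of_ne hi
    gcongr
    linarith

theorem norm_L₀_component (x : S.L₀.domain) (i : G × ℝ) :
    ‖(S.proj i (S.L₀ x) : 𝓗)‖ = i.2 * ‖(S.proj i x : 𝓗)‖ := by
  rw [S.proj_L₀]
  by_cases hi : S.proj i (x : 𝓗) = 0
  · simp [hi]
  · have := S.proj_nonneg_of_ne hi
    rw [Submodule.coe_smul, norm_smul, Complex.norm_real, Real.norm_of_nonneg this]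

theorem mem_powDomain_iff (l : ℕ) (Ψ : 𝓗) : Ψ ∈ powDomain S.L₀ l ↔ S.WeightSummable l Ψ := by
  induction l generalizing Ψ with
  | zero => exact ⟨fun _ => S.weightSummable_zero Ψ, fun _ => Submodule.mem_top⟩
  | succ l ih =>
    rw [mem_powDomain_succ]
    constructor
    · rintro ⟨h, h'⟩
      have h1 := (ih _).mp h'
      have h2 := (ih Ψ).mp (S.powDomain_succ_le l (S.mem_powDomain_succ.mpr ⟨h, h'⟩))
      have h3 := (h1.add h2).mul_left 2
      refine Summable.of_nonneg_of_le (fun i => sq_nonneg _) (fun i => ?_) h3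
      rw [S.norm_L₀_component]
      have := sq_nonneg ((1 + i.2) ^ l * (i.2 * ‖(S.proj i Ψ : 𝓗)‖) -
        (1 + i.2) ^ l * ‖(S.proj i Ψ : 𝓗)‖)
      rw [pow_succ _ l]
      dsimp only
      nlinarith
    · intro h
      have hd : Ψ ∈ S.L₀.domain := by
        rw [S.mem_L₀_domain_iff]
        refine Summable.of_nonneg_of_le (fun i => sq_nonneg _) (fun i => ?_)
          (S.weightSummable_mono (Nat.le_add_left 1 l) h)
        by_cases hi : S.proj i Ψ = 0
        · simp [hi]
        · have := S.proj_nonneg_of_ne hi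
          rw [norm_smul, Complex.norm_real, Real.norm_of_nonneg this, pow_one]
          gcongr
          linarith
      refine ⟨hd, (ih _).mpr ?_⟩
      refine Summable.of_nonneg_of_le (fun i => sq_nonneg _) (fun i => ?_) h
      rw [S.norm_L₀_component]
      by_cases hi : S.proj i Ψ = 0
      · simp [hi]
      · have := S.proj_nonneg_of_ne hi
        rw [pow_succ _ l, mul_assoc]
        gcongr
        linarith

theorem mem_smoothVectors_iff {Ψ : 𝓗} :
    Ψ ∈ smoothVectors S.L₀ ↔ ∀ l : ℕ, S.WeightSummable l Ψ := by
  simp only [smoothVectors, Submodule.mem_iInf, S.mem_powDomain_iff]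

theorem homog_le_smoothVectors (i : G × ℝ) : S.homog i.1 i.2 ≤ smoothVectors S.L₀ := by
  intro x hx
  rw [S.mem_smoothVectors_iff]
  intro l
  refine summable_of_ne_finset_zero (s := {i}) fun j hj => ?_
  rw [S.proj_of_mem_of_ne (by simpa using hj) hx]
  simp

end EnergyGrading

/-! ### Summability of modes applied to smooth vectors -/

/-- The sums of `(1 + |s|) ^ (-2)` over sets of points with distinct integral parts are uniformly
bounded. -/
theorem exists_sum_inv_sq_le : ∃ U : ℝ, 0 ≤ U ∧ ∀ (ι : Type _) (T : Finset ι) (s : ι → ℝ),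
    Set.InjOn (fun x => ⌊s x⌋) T → ∑ x ∈ T, ((1 + |s x|) ^ 2)⁻¹ ≤ U := by
  have hsum : Summable fun n : ℤ => 4 * ((1 + |(n : ℝ)|) ^ 2)⁻¹ := by
    have h : Summable fun n : ℕ => ((1 + (n : ℝ)) ^ 2)⁻¹ := by
      have := (summable_nat_add_iff 1).mpr (Real.summable_one_div_nat_pow.mpr one_lt_two)
      refine this.congr fun n => ?_
      push_cast
      rw [one_div, add_comm]
    refine Summable.mul_left 4 (Summable.of_nat_of_neg ?_ ?_)
    · simpa using h
    · simpa using h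
  refine ⟨∑' n : ℤ, 4 * ((1 + |(n : ℝ)|) ^ 2)⁻¹, tsum_nonneg fun n => by positivity,
    fun ι T s hT => ?_⟩
  classical
  calc ∑ x ∈ T, ((1 + |s x|) ^ 2)⁻¹ ≤ ∑ x ∈ T, 4 * ((1 + |(⌊s x⌋ : ℝ)|) ^ 2)⁻¹ := by
        refine Finset.sum_le_sum fun x _ => ?_
        have h1 : 1 + |(⌊s x⌋ : ℝ)| ≤ 2 * (1 + |s x|) := by
          have h2 : |(⌊s x⌋ : ℝ)| ≤ |s x| + 1 := by
            have := Int.floor_le (s x)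
            have := Int.lt_floor_add_one (s x)
            rw [abs_le]
            constructor <;> linarith [neg_abs_le (s x), le_abs_self (s x)]
          linarith [abs_nonneg (s x)]
        rw [← div_eq_mul_inv, inv_eq_one_div, div_le_div_iff₀ (by positivity) (by positivity)]
        calc 1 * (1 + |(⌊s x⌋ : ℝ)|) ^ 2 ≤ 1 * (2 * (1 + |s x|)) ^ 2 := by gcongr
          _ = _ := by ring
    _ = ∑ n ∈ T.image fun x => ⌊s x⌋, 4 * ((1 + |(n : ℝ)|) ^ 2)⁻¹ :=
      (Finset.sum_image (f := fun n : ℤ => 4 * ((1 + |(n : ℝ)|) ^ 2)⁻¹) hT).symm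
    _ ≤ _ := hsum.sum_le_tsum _ fun n _ => by positivity

theorem injOn_floor_of_sub_int {ι : Type*} {T : Set ι} {s : ι → ℝ} (hs : Set.InjOn s T) (ℓ : ℝ)
    (h : ∀ x ∈ T, ∃ n : ℤ, s x = ℓ + n) : Set.InjOn (fun x => ⌊s x⌋) T := by
  intro x hx y hy hxy
  obtain ⟨n, hn⟩ := h x hx
  obtain ⟨m, hm⟩ := h y hy
  simp only [hn, hm, Int.floor_add_intCast, add_right_inj] at hxy
  exact hs hx hy (by rw [hn, hm, hxy])

namespace EnergyGrading

variable {G : Type*} {𝓗 : Type*} [NormedAddCommGroup 𝓗] [InnerProductSpace ℂ 𝓗]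
  [CompleteSpace 𝓗] (S : EnergyGrading G 𝓗)

/-- Vectors of different charge or energy are orthogonal, and the Cauchy–Schwarz inequality with
the weights `a` bounds the sums of vectors of the same charge and energy. -/
theorem norm_sum_sq_le_of_fibers {X : Type*} {v : X → 𝓗} (key : X → G × ℝ)
    (hv : ∀ x, v x ∈ S.homog (key x).1 (key x).2) {a : X → ℝ} (ha : ∀ x, 0 < a x) {A : ℝ}
    (hA : ∀ (T : Finset X) (j : G × ℝ), (∀ x ∈ T, key x = j ∧ v x ≠ 0) → ∑ x ∈ T, a x ≤ A)
    (T : Finset X) : ‖∑ x ∈ T, v x‖ ^ 2 ≤ A * ∑ x ∈ T, ‖v x‖ ^ 2 / a x := by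
  classical
  set T' := T.filter fun x => v x ≠ 0 with hT'
  have h1 : ∑ x ∈ T, v x = ∑ j ∈ T'.image key, ∑ x ∈ T' with key x = j, v x := by
    rw [Finset.sum_fiberwise_of_maps_to fun x hx => Finset.mem_image_of_mem key hx, hT',
      Finset.sum_filter_ne_zero]
  have hmem : ∀ j : G × ℝ, ∑ x ∈ T' with key x = j, v x ∈ S.homog j.1 j.2 := fun j =>
    Submodule.sum_mem _ fun x hx => by
      rw [← (Finset.mem_filter.mp hx).2]; exact hv x
  have h2 := S.orthogonalFamily_homog.norm_sum
    (fun j => ⟨∑ x ∈ T' with key x = j, v x, hmem j⟩) (T'.image key)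
  simp only [Submodule.coe_subtypeₗᵢ, Submodule.subtype_apply, Submodule.coe_norm] at h2
  rw [h1, h2]
  have h3 : ∀ j : G × ℝ, ‖∑ x ∈ T' with key x = j, v x‖ ^ 2 ≤
      A * ∑ x ∈ T' with key x = j, ‖v x‖ ^ 2 / a x := by
    intro j
    have hpos : 0 ≤ ∑ x ∈ T' with key x = j, ‖v x‖ ^ 2 / a x :=
      Finset.sum_nonneg fun x _ => div_nonneg (sq_nonneg _) (ha x).le
    calc _ ≤ (∑ x ∈ T' with key x = j, ‖v x‖) ^ 2 := by gcongr; exact norm_sum_le _ _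
      _ ≤ (∑ x ∈ T' with key x = j, a x) * ∑ x ∈ T' with key x = j, ‖v x‖ ^ 2 / a x :=
        Finset.sum_sq_le_sum_mul_sum_of_sq_le_mul _ (fun x _ => (ha x).le)
          (fun x _ => div_nonneg (sq_nonneg _) (ha x).le)
          (fun x _ => (mul_div_cancel₀ _ (ha x).ne').ge)
      _ ≤ _ := by
        gcongr
        refine hA _ j fun x hx => ?_
        simp only [hT', Finset.mem_filter] at hx
        exact ⟨hx.2, hx.1.2⟩
  refine (Finset.sum_le_sum fun j _ => h3 j).trans ?_
  rw [← Finset.mul_sum,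
    Finset.sum_fiberwise_of_maps_to fun x hx => Finset.mem_image_of_mem key hx, hT',
    Finset.sum_filter_of_ne]
  intro x _ hx hx0
  simp [hx0] at hx

theorem summable_of_fibers {X : Type*} {v : X → 𝓗} (key : X → G × ℝ)
    (hv : ∀ x, v x ∈ S.homog (key x).1 (key x).2) {a : X → ℝ} (ha : ∀ x, 0 < a x) {A : ℝ}
    (hA0 : 0 ≤ A)
    (hA : ∀ (T : Finset X) (j : G × ℝ), (∀ x ∈ T, key x = j ∧ v x ≠ 0) → ∑ x ∈ T, a x ≤ A)
    (hsum : Summable fun x => ‖v x‖ ^ 2 / a x) : Summable v := by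
  rw [summable_iff_vanishing_norm] at hsum ⊢
  intro ε hε
  obtain ⟨T, hT⟩ := hsum (ε ^ 2 / (A + 1)) (by positivity)
  refine ⟨T, fun T' hT' => ?_⟩
  have h1 := S.norm_sum_sq_le_of_fibers key hv ha hA T'
  have h2 := (le_abs_self _).trans_lt (hT T' hT')
  rw [lt_div_iff₀ (by positivity)] at h2
  have h3 : 0 ≤ ∑ x ∈ T', ‖v x‖ ^ 2 / a x :=
    Finset.sum_nonneg fun x _ => div_nonneg (sq_nonneg _) (ha x).le
  exact lt_of_pow_lt_pow_left₀ 2 hε.le (by nlinarith)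

/-- Vectors `v (s, (g, t))` of charge `h * g` and energy `t - s` are summable if their decay in `s`
beats `(1 + |s|) ^ (-2)`, with square summable bounds in `(g, t)`. -/
theorem summable_of_shift [Group G] (h : G) {v : ℝ × G × ℝ → 𝓗}
    (hv : ∀ x, v x ∈ S.homog (h * x.2.1) (x.2.2 - x.1))
    (hv0 : ∀ x, v x ≠ 0 → ∃ n : ℕ, x.2.2 = S.lowestEnergy x.2.1 + n) {b : G × ℝ → ℝ}
    (hb : Summable fun i => b i ^ 2) (hvb : ∀ x, ‖v x‖ * (1 + |x.1|) ^ 2 ≤ b x.2) :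
    Summable v := by
  classical
  obtain ⟨U, hU0, hU⟩ := exists_sum_inv_sq_le
  refine S.summable_of_fibers (fun x => (h * x.2.1, x.2.2 - x.1)) hv
    (a := fun x => ((1 + |x.1|) ^ 2)⁻¹) (fun x => by positivity) hU0 ?_ ?_
  · intro T j hT
    refine hU _ T (fun x => x.1) (injOn_floor_of_sub_int ?_ (S.lowestEnergy (h⁻¹ * j.1) - j.2) ?_)
    · intro x hx y hy hxy
      have hx := (hT x hx).1
      have hy := (hT y hy).1
      rw [← hy, Prod.mk.injEq] at hx
      have hxy : x.1 = y.1 := hxy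
      refine Prod.ext hxy (Prod.ext (mul_left_cancel hx.1) ?_)
      linarith [hx.2]
    · intro x hx
      obtain ⟨hx1, hx2⟩ := hT x hx
      obtain ⟨n, hn⟩ := hv0 x hx2
      refine ⟨n, ?_⟩
      rw [← hx1]
      simp only [inv_mul_cancel_left, Int.cast_natCast]
      linarith
  · refine summable_of_sum_le (c := U * ∑' i, b i ^ 2)
      (fun x => div_nonneg (sq_nonneg _) (by positivity)) fun T => ?_
    set T' := T.filter fun x => v x ≠ 0 with hT'
    have h1 : ∑ x ∈ T, ‖v x‖ ^ 2 / ((1 + |x.1|) ^ 2)⁻¹ =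
        ∑ i ∈ T'.image Prod.snd, ∑ x ∈ T' with x.2 = i, ‖v x‖ ^ 2 / ((1 + |x.1|) ^ 2)⁻¹ := by
      rw [Finset.sum_fiberwise_of_maps_to fun x hx => Finset.mem_image_of_mem Prod.snd hx, hT',
        Finset.sum_filter_of_ne]
      intro x _ hx hx0
      simp [hx0] at hx
    have h2 : ∀ i, ∑ x ∈ T' with x.2 = i, ‖v x‖ ^ 2 / ((1 + |x.1|) ^ 2)⁻¹ ≤ U * b i ^ 2 := by
      intro i
      calc _ ≤ ∑ x ∈ T' with x.2 = i, ((1 + |x.1|) ^ 2)⁻¹ * b i ^ 2 := by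
            refine Finset.sum_le_sum fun x hx => ?_
            have hxi := (Finset.mem_filter.mp hx).2
            have h3 := hvb x
            rw [hxi] at h3
            rw [div_inv_eq_mul, ← div_eq_inv_mul, le_div_iff₀ (by positivity)]
            calc ‖v x‖ ^ 2 * (1 + |x.1|) ^ 2 * (1 + |x.1|) ^ 2 =
                  (‖v x‖ * (1 + |x.1|) ^ 2) ^ 2 := by ring
              _ ≤ _ := by gcongr
        _ = (∑ x ∈ T' with x.2 = i, ((1 + |x.1|) ^ 2)⁻¹) * b i ^ 2 := by rw [Finset.sum_mul]
        _ ≤ _ := by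
          gcongr
          refine hU _ _ (fun x : ℝ × G × ℝ => x.1) ?_
          by_cases hne : ∃ x ∈ T', x.2 = i
          · obtain ⟨x₀, -, hx₀⟩ := hne
            refine injOn_floor_of_sub_int ?_ (i.2 - S.lowestEnergy (h * i.1)) ?_
            · intro x hx y hy hxy
              have hx := (Finset.mem_filter.mp hx).2
              have hy := (Finset.mem_filter.mp hy).2
              exact Prod.ext hxy (hx.trans hy.symm)
            · intro x hx
              have hx := Finset.mem_filter.mp hx
              have hx0 : v x ≠ 0 := (Finset.mem_filter.mp hx.1).2
              obtain ⟨n, hn⟩ := S.exists_energy_eq (hv x) hx0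
              refine ⟨-n, ?_⟩
              rw [← hx.2]
              push_cast
              linarith
          · intro x hx
            exact absurd ⟨x, (Finset.mem_filter.mp hx).1, (Finset.mem_filter.mp hx).2⟩ hne
    rw [h1]
    calc _ ≤ ∑ i ∈ T'.image Prod.snd, U * b i ^ 2 := Finset.sum_le_sum fun i _ => h2 i
      _ = U * ∑ i ∈ T'.image Prod.snd, b i ^ 2 := by rw [Finset.mul_sum]
      _ ≤ _ := by
        gcongr
        exact hb.sum_le_tsum _ fun i _ => sq_nonneg _

theorem homog_le_finSector (g : G) (t : ℝ) : S.homog g t ≤ S.finSector g := le_iSup (S.homog g) t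

theorem finSector_le_sector (g : G) : S.finSector g ≤ S.sector g :=
  iSup_le fun _ => inf_le_left

theorem addOnePow_of_mem {i : G × ℝ} {x : S.fin} (hx : (x : 𝓗) ∈ S.homog i.1 i.2) (p : ℝ) :
    S.addOnePow p x = (((i.2 + 1) ^ p : ℝ) : ℂ) • (x : 𝓗) := by
  rw [addOnePow, tsum_eq_single i, S.proj_of_mem hx]
  intro j hj
  rw [S.proj_of_mem_of_ne hj hx]
  simp

theorem extend_of_mem (A : Module.End ℂ S.fin) {i : G × ℝ} {x : S.fin}
    (hx : (x : 𝓗) ∈ S.homog i.1 i.2) : S.extend A x = A x := by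
  rw [extend, tsum_eq_single i]
  · congr 2; exact Subtype.ext (S.proj_of_mem hx)
  · intro j hj
    rw [S.proj_of_mem_of_ne hj hx]
    simp

theorem inner_finsum_smul (y : 𝓗) (a : ℕ → ℂ) {V : ℕ → S.fin}
    (hV : (Function.support V).Finite) :
    ⟪y, ((∑ᶠ n, a n • V n : S.fin) : 𝓗)⟫_ℂ = ∑' n, a n * ⟪y, (V n : 𝓗)⟫_ℂ := by
  let T : S.fin →ₗ[ℂ] ℂ := (innerₛₗ ℂ y).comp S.fin.subtype
  have h1 : (Function.support fun n => a n • V n).Finite :=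
    hV.subset fun n hn h0 => hn (by simp [h0])
  have h2 : (Function.support fun n => a n * ⟪y, (V n : 𝓗)⟫_ℂ).Finite :=
    hV.subset fun n hn h0 => hn (by simp [h0])
  rw [tsum_eq_finsum h2]
  refine (T.toAddMonoidHom.map_finsum h1).trans (finsum_congr fun n => ?_)
  exact (T.map_smul _ _).trans rfl

end EnergyGrading

/-! ### Modes of charged primary fields -/

namespace ChargedPrimaryFields

variable {G : Type*} [Group G] {J : Type*} {𝓗 : Type*} [NormedAddCommGroup 𝓗]
  [InnerProductSpace ℂ 𝓗] [CompleteSpace 𝓗] {S : ChiralSectors G J 𝓗} {Ξ : G → Type*}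
  (F : ChargedPrimaryFields S Ξ) {h : G} (ξ : Ξ h)

/-- The mode `s` of a field of charge `h` adds the charge `h` and lowers the energy by `s`. -/
theorem mode_mem_homog (s : ℝ) {g : G} {t : ℝ} {x : S.fin} (hx : (x : 𝓗) ∈ S.homog g t) :
    (F.ψ h ξ s x : 𝓗) ∈ S.homog (h * g) (t - s) := by
  have hfin := F.ψ_sector h ξ s g x (S.homog_le_finSector g t hx)
  refine ⟨S.finSector_le_sector _ hfin, ?_⟩
  have hL : S.L 0 x = (t : ℂ) • x := by
    obtain ⟨h1, h2⟩ := S.L_zero x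
    obtain ⟨h3, h4⟩ := mem_eigenSubspace.mp hx.2
    exact Subtype.ext (h2.trans h4)
  have hp := congrArg (fun B : Module.End ℂ S.fin => B x) (F.primarity 0 h ξ s)
  simp only [LinearMap.sub_apply, Module.End.mul_apply, LinearMap.smul_apply, hL, map_smul,
    Int.cast_zero, mul_zero, zero_sub, zero_add] at hp
  obtain ⟨h1, h2⟩ := S.L_zero (F.ψ h ξ s x)
  refine mem_eigenSubspace.mpr ⟨h1, ?_⟩
  rw [← h2, ← Submodule.coe_smul]
  congr 1
  rw [sub_eq_iff_eq_add] at hp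
  rw [hp, ← add_smul]
  congr 1
  push_cast
  ring

/-- The polynomial energy bound, for a vector of definite energy and with integral exponents. -/
theorem exists_norm_mode_le : ∃ (r p : ℕ) (C : ℝ), 0 ≤ C ∧ ∀ (s : ℝ) (i : G × ℝ) (x : S.fin),
    (x : 𝓗) ∈ S.homog i.1 i.2 →
      ‖(F.ψ h ξ s x : 𝓗)‖ ≤ C * (1 + |s|) ^ r * ((1 + i.2) ^ p * ‖(x : 𝓗)‖) := by
  obtain ⟨r, p, C, hr, hp, hC, hb⟩ := F.energyBound h ξ
  refine ⟨⌈r⌉₊, ⌈p⌉₊, C, hC, fun s i x hx => ?_⟩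
  by_cases hx0 : (x : 𝓗) = 0
  · have : x = 0 := Subtype.ext hx0
    simp [this]
  have ht := S.energy_nonneg hx hx0
  refine (hb s x).trans ?_
  rw [S.addOnePow_of_mem hx, norm_smul, Complex.norm_real, Real.norm_of_nonneg (by positivity),
    ← Real.rpow_natCast, ← Real.rpow_natCast, add_comm i.2]
  gcongr
  · linarith [abs_nonneg s]
  · exact Nat.le_ceil r
  · linarith
  · exact Nat.le_ceil p

/-- The terms of a smeared field with arbitrary coefficients, applied to a smooth vector, are
summable even when weighted with powers of the energy of the resulting vectors. -/
theorem summable_weighted_modes {φ : ℝ → ℂ} (hφ : RapidDecay φ) {Ψ : 𝓗}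
    (hΨ : Ψ ∈ smoothVectors S.L₀) (l : ℕ) :
    Summable fun x : ℝ × G × ℝ => (((1 + (x.2.2 - x.1)) ^ l : ℝ) : ℂ) •
      φ x.1 • (F.ψ h ξ x.1 (S.proj x.2 Ψ) : 𝓗) := by
  obtain ⟨r, p, C, hC, hb⟩ := F.exists_norm_mode_le ξ
  obtain ⟨K, hK⟩ := hφ (l + r + 2)
  have hK0 : 0 ≤ K := le_trans (by positivity) (hK 0)
  have hmem : ∀ x : ℝ × G × ℝ,
      (F.ψ h ξ x.1 (S.proj x.2 Ψ) : 𝓗) ∈ S.homog (h * x.2.1) (x.2.2 - x.1) := fun x =>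
    F.mode_mem_homog ξ x.1 (S.proj_mem x.2 Ψ)
  refine S.summable_of_shift h
    (b := fun i => C * K * ((1 + i.2) ^ (l + p) * ‖(S.proj i Ψ : 𝓗)‖))
    (fun x => Submodule.smul_mem _ _ (Submodule.smul_mem _ _ (hmem x))) ?_ ?_ ?_
  · intro x hx
    refine S.exists_energy_eq (S.proj_mem x.2 Ψ) fun h0 => hx ?_
    have : S.proj x.2 Ψ = 0 := Subtype.ext h0
    simp [this]
  · have := (S.mem_smoothVectors_iff.mp hΨ (l + p)).mul_left ((C * K) ^ 2)
    simpa only [mul_pow] using this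
  · rintro ⟨s, i⟩
    simp only
    have hnonneg := mul_nonneg (mul_nonneg hC hK0) (S.weight_nonneg (l + p) i Ψ)
    by_cases h0 : (F.ψ h ξ s (S.proj i Ψ) : 𝓗) = 0
    · simpa [h0] using hnonneg
    have hu : 0 ≤ i.2 - s := S.energy_nonneg (hmem (s, i)) h0
    have ht : 0 ≤ i.2 := S.proj_nonneg_of_ne (Ψ := Ψ) fun h1 => h0 (by simp [h1])
    have hw : 1 + (i.2 - s) ≤ (1 + i.2) * (1 + |s|) := by
      have := mul_nonneg ht (abs_nonneg s)
      linarith [neg_abs_le s]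
    rw [norm_smul, norm_smul, Complex.norm_real, Real.norm_of_nonneg (by positivity)]
    calc (1 + (i.2 - s)) ^ l * (‖φ s‖ * ‖(F.ψ h ξ s (S.proj i Ψ) : 𝓗)‖) * (1 + |s|) ^ 2
        ≤ ((1 + i.2) * (1 + |s|)) ^ l * (‖φ s‖ * (C * (1 + |s|) ^ r *
          ((1 + i.2) ^ p * ‖(S.proj i Ψ : 𝓗)‖))) * (1 + |s|) ^ 2 := by
          gcongr
          exact hb s i _ (S.proj_mem i Ψ)
      _ = C * (‖φ s‖ * (1 + |s|) ^ (l + r + 2)) *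
          ((1 + i.2) ^ (l + p) * ‖(S.proj i Ψ : 𝓗)‖) := by
        rw [mul_pow, pow_add, pow_add, pow_add]; ring
      _ ≤ _ := by
        gcongr
        exact hK s

theorem summable_modes {φ : ℝ → ℂ} (hφ : RapidDecay φ) {Ψ : 𝓗}
    (hΨ : Ψ ∈ smoothVectors S.L₀) :
    Summable fun x : ℝ × G × ℝ => φ x.1 • (F.ψ h ξ x.1 (S.proj x.2 Ψ) : 𝓗) := by
  simpa using F.summable_weighted_modes ξ hφ hΨ 0

theorem summable_mode (s : ℝ) {Ψ : 𝓗} (hΨ : Ψ ∈ smoothVectors S.L₀) :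
    Summable fun i : G × ℝ => (F.ψ h ξ s (S.proj i Ψ) : 𝓗) := by
  classical
  -- a single mode is the sum of all modes with the coefficients `Pi.single s 1`
  have hφ : RapidDecay (Pi.single s 1) := fun M => ⟨(1 + |s|) ^ M, fun u => by
    rcases eq_or_ne u s with rfl | hu
    · simp
    · simp [hu]
      positivity⟩
  simpa using (F.summable_modes ξ hφ hΨ).prod_factor s

theorem hasSum_smear {f : Circle → ℂ} (hf : IsTestFunction f) {Ψ : 𝓗}
    (hΨ : Ψ ∈ smoothVectors S.L₀) :
    HasSum (fun s => circleCoeff f s • S.extend (F.ψ h ξ s) Ψ) (S.smear (F.ψ h ξ) f Ψ) := by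
  have := (F.summable_modes ξ (rapidDecay_circleCoeff hf) hΨ).prod
  simp only [tsum_const_smul''] at this
  exact this.hasSum

theorem hasSum_smear_modes {f : Circle → ℂ} (hf : IsTestFunction f) {Ψ : 𝓗}
    (hΨ : Ψ ∈ smoothVectors S.L₀) :
    HasSum (fun x : ℝ × G × ℝ => circleCoeff f x.1 • (F.ψ h ξ x.1 (S.proj x.2 Ψ) : 𝓗))
      (S.smear (F.ψ h ξ) f Ψ) := by
  have hs := F.summable_modes ξ (rapidDecay_circleCoeff hf) hΨ
  convert! hs.hasSum using 1
  rw [hs.tsum_prod]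
  simp only [tsum_const_smul'']
  rfl

theorem smear_mem_smoothVectors {f : Circle → ℂ} (hf : IsTestFunction f) {Ψ : 𝓗}
    (hΨ : Ψ ∈ smoothVectors S.L₀) : S.smear (F.ψ h ξ) f Ψ ∈ smoothVectors S.L₀ := by
  rw [S.mem_smoothVectors_iff]
  intro l
  have h0 := F.hasSum_smear_modes ξ hf hΨ
  obtain ⟨Φ, hΦ⟩ := F.summable_weighted_modes ξ (rapidDecay_circleCoeff hf) hΨ l
  -- `Φ` plays the role of `(1 + L₀) ^ l` applied to the smeared vector
  have key : ∀ j : G × ℝ, (S.proj j Φ : 𝓗) =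
      (((1 + j.2) ^ l : ℝ) : ℂ) • (S.proj j (S.smear (F.ψ h ξ) f Ψ) : 𝓗) := by
    intro j
    refine (S.proj_sum hΦ j).unique ?_
    convert! (S.proj_sum h0 j).const_smul (((1 + j.2) ^ l : ℝ) : ℂ) using 2 with x
    have hx := Submodule.smul_mem _ (circleCoeff f x.1)
      (F.mode_mem_homog ξ x.1 (S.proj_mem x.2 Ψ))
    rw [S.proj_smul]
    by_cases hj : j = (h * x.2.1, x.2.2 - x.1)
    · rw [hj, Submodule.coe_smul]
    · rw [S.proj_of_mem_of_ne hj hx]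
      simp
  have hz := S.weightSummable_zero Φ
  refine hz.congr fun j => ?_
  rw [key, norm_smul, Complex.norm_real, Real.norm_eq_abs, pow_zero, one_mul, mul_pow, mul_pow,
    sq_abs]

theorem smearDefined {f : Circle → ℂ} (hf : IsTestFunction f) : S.SmearDefined (F.ψ h ξ) f :=
  fun _ hΨ => ⟨fun s => F.summable_mode ξ s hΨ, (F.hasSum_smear ξ hf hΨ).summable,
    F.smear_mem_smoothVectors ξ hf hΨ⟩

end ChargedPrimaryFields

/-! ### Adjoints of smeared fields -/

namespace ChargedPrimaryFields

variable {G : Type*} [Group G] {J : Type*} {𝓗 : Type*} [NormedAddCommGroup 𝓗]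
  [InnerProductSpace ℂ 𝓗] [CompleteSpace 𝓗] {S : ChiralSectors G J 𝓗} {Ξ : G → Type*}
  (F : ChargedPrimaryFields S Ξ)

/-- Adjointness of modes on finite-energy vectors passes to their extensions to smooth vectors. -/
theorem inner_extend {h h' : G} {ξ : Ξ h} {ξ' : Ξ h'}
    (hadj : ∀ s (x y : S.fin), ⟪(F.ψ h ξ s x : 𝓗), y⟫_ℂ = ⟪(x : 𝓗), F.ψ h' ξ' (-s) y⟫_ℂ)
    (s : ℝ) {Φ Ψ : 𝓗} (hΦ : Φ ∈ smoothVectors S.L₀)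
    (hΨ : Ψ ∈ smoothVectors S.L₀) :
    ⟪S.extend (F.ψ h ξ s) Φ, Ψ⟫_ℂ = ⟪Φ, S.extend (F.ψ h' ξ' (-s)) Ψ⟫_ℂ := by
  have h1 : ∀ x : S.fin, ⟪(F.ψ h ξ s x : 𝓗), Ψ⟫_ℂ = ⟪(x : 𝓗), S.extend (F.ψ h' ξ' (-s)) Ψ⟫_ℂ := by
    intro x
    have h2 := (S.hasSum_proj Ψ).mapL (innerSL ℂ (F.ψ h ξ s x : 𝓗))
    have h3 := (F.summable_mode ξ' (-s) hΨ).hasSum.mapL (innerSL ℂ (x : 𝓗))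
    simp only [innerSL_apply_apply, hadj] at h2 h3
    exact h2.unique h3
  have h2 := (F.summable_mode ξ s hΦ).hasSum.mapL (innerSLFlip ℂ Ψ)
  have h3 := (S.hasSum_proj Φ).mapL (innerSLFlip ℂ (S.extend (F.ψ h' ξ' (-s)) Ψ))
  simp only [innerSLFlip_apply_apply, h1] at h2 h3
  exact h2.unique h3

theorem inner_smear {h h' : G} {ξ : Ξ h} {ξ' : Ξ h'}
    (hadj : ∀ s (x y : S.fin), ⟪(F.ψ h ξ s x : 𝓗), y⟫_ℂ = ⟪(x : 𝓗), F.ψ h' ξ' (-s) y⟫_ℂ)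
    {f : Circle → ℂ} (hf : IsTestFunction f) {Φ Ψ : 𝓗}
    (hΦ : Φ ∈ smoothVectors S.L₀) (hΨ : Ψ ∈ smoothVectors S.L₀) :
    ⟪S.smear (F.ψ h ξ) f Φ, Ψ⟫_ℂ =
      ⟪Φ, S.smear (F.ψ h' ξ') (fun z => starRingEnd ℂ (f z)) Ψ⟫_ℂ := by
  have h2 := (F.hasSum_smear ξ hf hΦ).mapL (innerSLFlip ℂ Ψ)
  have h3 := (F.hasSum_smear ξ' hf.star hΨ).mapL (innerSL ℂ Φ)
  rw [← (Equiv.neg ℝ).hasSum_iff] at h3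
  simp only [innerSLFlip_apply_apply, innerSL_apply_apply, Function.comp_def, Equiv.neg_apply,
    circleCoeff_star, neg_neg, inner_smul_left, inner_smul_right,
    F.inner_extend hadj _ hΦ hΨ] at h2 h3
  exact h2.unique h3

/-- Every smeared field has a formal adjoint on the smooth vectors, again a smeared field. -/
theorem exists_adjoint {h : G} (ξ : Ξ h) : ∃ (h' : G) (ξ' : Ξ h'), ∀ {f : Circle → ℂ},
    IsTestFunction f → ∀ {Φ Ψ : 𝓗}, Φ ∈ smoothVectors S.L₀ → Ψ ∈ smoothVectors S.L₀ →
      ⟪Φ, S.smear (F.ψ h ξ) f Ψ⟫_ℂ =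
        ⟪S.smear (F.ψ h' ξ') (fun z => starRingEnd ℂ (f z)) Φ, Ψ⟫_ℂ := by
  obtain ⟨h', ξ', hadj⟩ := F.conjugation h ξ
  refine ⟨h', ξ', fun {f} hf {Φ Ψ} hΦ hΨ => ?_⟩
  rw [← inner_conj_symm, F.inner_smear hadj hf hΨ hΦ, inner_conj_symm]

/-! ### Matrix elements of products of two fields -/

section MatrixElements

variable {h₁ h₂ : G} (ξ₁ : Ξ h₁) (ξ₂ : Ξ h₂)

/-- The matrix element between `y` and `x` of the product of the mode `N - s` of the first field
and the mode `s` of the second. -/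
def matrixElement (y : 𝓗) (x : S.fin) (N s : ℝ) : ℂ :=
  ⟪y, (F.ψ h₁ ξ₁ (N - s) (F.ψ h₂ ξ₂ s x) : 𝓗)⟫_ℂ

/-- As the energies of each charge are discrete, so are the modes that act on a given vector. -/
theorem exists_mode_eq {h : G} (ξ : Ξ h) {i : G × ℝ} {x : S.fin}
    (hx : (x : 𝓗) ∈ S.homog i.1 i.2) {s : ℝ} (hs : F.ψ h ξ s x ≠ 0) :
    ∃ n : ℕ, s = i.2 - S.lowestEnergy (h * i.1) - n := by
  obtain ⟨n, hn⟩ := S.exists_energy_eq (F.mode_mem_homog ξ s hx) (by simpa using hs)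
  exact ⟨n, by linarith⟩

theorem finite_support_mode {h : G} (ξ : Ξ h) {i : G × ℝ} {x : S.fin}
    (hx : (x : 𝓗) ∈ S.homog i.1 i.2) (m : ℝ) :
    (Function.support fun n : ℕ => F.ψ h ξ (m + n) x).Finite := by
  refine (Set.finite_le_nat ⌈i.2 - m⌉₊).subset fun n hn => ?_
  have h0 := S.energy_nonneg (F.mode_mem_homog ξ (m + n) hx) (by simpa using hn)
  have : (n : ℝ) ≤ i.2 - m := by linarith
  exact_mod_cast this.trans (Nat.le_ceil _)

theorem supportedBelow_matrixElement (y : 𝓗) {i : G × ℝ} {x : S.fin}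
    (hx : (x : 𝓗) ∈ S.homog i.1 i.2) (N : ℝ) :
    SupportedBelow (i.2 - S.lowestEnergy (h₂ * i.1)) (F.matrixElement ξ₁ ξ₂ y x N) := by
  intro s hs
  refine F.exists_mode_eq ξ₂ hx fun h0 => hs ?_
  simp [matrixElement, h0]

/-- Only the modes with sum `i.2 - j.2` contribute to a matrix element from energy `i.2` to energy
`j.2`, so that a matrix element of a product of smeared fields is a single sum. -/
theorem inner_smear_smear {f g : Circle → ℂ} (hf : IsTestFunction f) (hg : IsTestFunction g)
    {i j : G × ℝ} {x : S.fin} (hx : (x : 𝓗) ∈ S.homog i.1 i.2) {y : 𝓗}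
    (hy : y ∈ S.homog j.1 j.2) :
    ⟪y, S.smear (F.ψ h₁ ξ₁) f (S.smear (F.ψ h₂ ξ₂) g x)⟫_ℂ =
      ∑' s : ℝ, circleCoeff f (i.2 - j.2 - s) * circleCoeff g s *
        F.matrixElement ξ₁ ξ₂ y x (i.2 - j.2) s := by
  obtain ⟨h', ξ', hadj⟩ := F.exists_adjoint ξ₁
  have hxs := S.homog_le_smoothVectors i hx
  have hys := S.homog_le_smoothVectors j hy
  rw [hadj hf hys (F.smear_mem_smoothVectors ξ₂ hg hxs)]
  have h1 := (F.hasSum_smear ξ₂ hg hxs).mapL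
    (innerSL ℂ (S.smear (F.ψ h' ξ') (fun z => starRingEnd ℂ (f z)) y))
  refine h1.tsum_eq.symm.trans (tsum_congr fun s => ?_)
  have hmode := F.mode_mem_homog ξ₂ s hx
  have hms := S.homog_le_smoothVectors (h₂ * i.1, i.2 - s) hmode
  rw [innerSL_apply_apply, S.extend_of_mem _ hx, inner_smul_right, ← hadj hf hys hms]
  have h2 := (F.hasSum_smear ξ₁ hf hms).mapL (innerSL ℂ y)
  rw [← innerSL_apply_apply ℂ y, ← h2.tsum_eq, tsum_eq_single (i.2 - j.2 - s)]
  · rw [innerSL_apply_apply, S.extend_of_mem (i := (h₂ * i.1, i.2 - s)) _ hmode, inner_smul_right,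
      matrixElement]
    ring
  · intro u hu
    rw [innerSL_apply_apply, S.extend_of_mem (i := (h₂ * i.1, i.2 - s)) _ hmode, inner_smul_right,
      S.homog_inner_eq_zero (j := (h₁ * (h₂ * i.1), i.2 - s - u)) ?_ hy
        (F.mode_mem_homog ξ₁ u hmode), mul_zero]
    intro hj
    apply hu
    rw [hj]
    simp only
    ring

/-- The braiding relation for matrix elements. -/
theorem binomialConv_matrixElement (y : 𝓗) {i : G × ℝ} {x : S.fin}
    (hx : (x : 𝓗) ∈ S.homog i.1 i.2) (N m : ℝ) :
    binomialConv (F.α h₁ h₂) (F.matrixElement ξ₁ ξ₂ y x N) m =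
      binomialConv (F.α h₁ h₂) (F.matrixElement ξ₂ ξ₁ y x N) (N - F.α h₁ h₂ - m) := by
  have hb := congrFun (congrFun (F.braiding h₁ h₂ ξ₁ ξ₂ x) (-(N - F.α h₁ h₂ - m) - F.D h₁))
    (-m - F.D h₂)
  have hL : mulLeftFactor (F.α h₁ h₂) (fun a b => fieldSeries (F.D h₁) (F.ψ h₁ ξ₁) a *
      fieldSeries (F.D h₂) (F.ψ h₂ ξ₂) b) x (-(N - F.α h₁ h₂ - m) - F.D h₁) (-m - F.D h₂) =
      ∑ᶠ n : ℕ, (oneSubPowCoeff (F.α h₁ h₂) n : ℂ) •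
        F.ψ h₁ ξ₁ (N - (m + n)) (F.ψ h₂ ξ₂ (m + n) x) := by
    refine finsum_congr fun n => ?_
    simp only [fieldSeries, Module.End.mul_apply]
    congr 3 <;> [skip; congr 1] <;> ring
  have hR : mulRightFactor (F.α h₁ h₂) (fun a b => fieldSeries (F.D h₂) (F.ψ h₂ ξ₂) b *
      fieldSeries (F.D h₁) (F.ψ h₁ ξ₁) a) x (-(N - F.α h₁ h₂ - m) - F.D h₁) (-m - F.D h₂) =
      ∑ᶠ n : ℕ, (oneSubPowCoeff (F.α h₁ h₂) n : ℂ) •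
        F.ψ h₂ ξ₂ (N - (N - F.α h₁ h₂ - m + n)) (F.ψ h₁ ξ₁ (N - F.α h₁ h₂ - m + n) x) := by
    refine finsum_congr fun n => ?_
    simp only [fieldSeries, Module.End.mul_apply]
    congr 3 <;> [skip; congr 1] <;> ring
  rw [hL, hR] at hb
  have hb' := congrArg (fun v : S.fin => ⟪y, (v : 𝓗)⟫_ℂ) hb
  rwa [S.inner_finsum_smul, S.inner_finsum_smul] at hb'
  · exact (F.finite_support_mode ξ₁ hx (N - F.α h₁ h₂ - m)).subset fun n hn h0 =>
      hn ((congrArg _ h0).trans (map_zero _))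
  · exact (F.finite_support_mode ξ₂ hx m).subset fun n hn h0 => hn ((congrArg _ h0).trans (map_zero _))

end MatrixElements

end ChargedPrimaryFields

/-- The boundary value at `-1` of the principal branch of `ζ ^ α` from the upper half plane. -/
theorem tendsto_cpow_neg_one (α : ℝ) :
    Filter.Tendsto (fun ζ : ℂ => ζ ^ (α : ℂ)) (𝓝[{ζ : ℂ | 0 < ζ.im}] (-1))
      (𝓝 (Complex.exp (α * Real.pi * Complex.I))) := by
  have h1 := Complex.tendsto_log_nhdsWithin_im_nonneg_of_re_neg_of_im_zero (z := -1)
    (by simp) (by simp)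
  have h2 : 𝓝[{ζ : ℂ | 0 < ζ.im}] (-1 : ℂ) ≤ 𝓝[{ζ : ℂ | 0 ≤ ζ.im}] (-1) :=
    nhdsWithin_mono _ fun ζ (hζ : 0 < ζ.im) => hζ.le
  have h3 := (Complex.continuous_exp.tendsto _).comp ((h1.mono_left h2).mul_const (α : ℂ))
  have h4 : (Real.log ‖(-1 : ℂ)‖ + Real.pi * Complex.I) * (α : ℂ) = α * Real.pi * Complex.I := by
    simp; ring
  rw [h4] at h3
  refine h3.congr' ?_
  filter_upwards [self_mem_nhdsWithin] with ζ hζ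
  have hζ0 : ζ ≠ 0 := by
    rintro rfl
    simp at hζ
  rw [Function.comp_apply, Complex.cpow_def_of_ne_zero hζ0]

end

theorem lemma5p4 {G : Type*} [Group G] {J : Type*} {𝓗 : Type*}
    [NormedAddCommGroup 𝓗] [InnerProductSpace ℂ 𝓗] [CompleteSpace 𝓗]
    (S : ChiralSectors G J 𝓗) {Ξ : G → Type*} (F : ChargedPrimaryFields S Ξ)
    (h₁ h₂ : G) (ξ₁ : Ξ h₁) (ξ₂ : Ξ h₂) (f g : Circle → ℂ)
    (hf : IsTestFunction f) (hg : IsTestFunction g)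
    (hfg : ∀ w ∈ tsupport f, ∀ z ∈ tsupport g, Complex.arg w < Complex.arg z) :
    S.SmearDefined (F.ψ h₁ ξ₁) f ∧ S.SmearDefined (F.ψ h₂ ξ₂) g ∧
    ∃ ε : ℂ,
      Filter.Tendsto (fun ζ : ℂ => ζ ^ (F.α h₁ h₂ : ℂ)) (𝓝[{ζ : ℂ | 0 < ζ.im}] (-1)) (𝓝 ε) ∧
      ∀ Ψ ∈ smoothVectors S.L₀,
        S.smear (F.ψ h₁ ξ₁) f (S.smear (F.ψ h₂ ξ₂) g Ψ) =
          ε • S.smear (F.ψ h₂ ξ₂) g (S.smear (F.ψ h₁ ξ₁) f Ψ) := by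
  refine ⟨F.smearDefined ξ₁ hf, F.smearDefined ξ₂ hg, _, tendsto_cpow_neg_one _, fun Ψ hΨ => ?_⟩
  set ε := Complex.exp (F.α h₁ h₂ * Real.pi * Complex.I)
  have hmatrix : ∀ (i j : G × ℝ) (x y : 𝓗), x ∈ S.homog i.1 i.2 → y ∈ S.homog j.1 j.2 →
      ⟪y, S.smear (F.ψ h₁ ξ₁) f (S.smear (F.ψ h₂ ξ₂) g x)⟫_ℂ =
        ε * ⟪y, S.smear (F.ψ h₂ ξ₂) g (S.smear (F.ψ h₁ ξ₁) f x)⟫_ℂ := by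
    intro i j x y hx hy
    have h1 := F.inner_smear_smear ξ₁ ξ₂ hf hg (x := ⟨x, S.homog_le_fin _ _ hx⟩) hx hy
    have h2 := F.inner_smear_smear ξ₂ ξ₁ hg hf (x := ⟨x, S.homog_le_fin _ _ hx⟩) hx hy
    rw [h1, h2, tsum_circleCoeff_eq_of_braiding hf hg hfg
      (F.supportedBelow_matrixElement ξ₁ ξ₂ y hx _) (F.supportedBelow_matrixElement ξ₂ ξ₁ y hx _)
      (F.binomialConv_matrixElement ξ₁ ξ₂ y hx _)]
    congr 1
    refine tsum_congr fun s => ?_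
    rw [mul_comm (circleCoeff f s)]
  obtain ⟨k₁, η₁, hadj₁⟩ := F.exists_adjoint ξ₁
  obtain ⟨k₂, η₂, hadj₂⟩ := F.exists_adjoint ξ₂
  have move₁₂ : ∀ {Φ Ψ : 𝓗}, Φ ∈ smoothVectors S.L₀ → Ψ ∈ smoothVectors S.L₀ →
      ⟪Φ, S.smear (F.ψ h₁ ξ₁) f (S.smear (F.ψ h₂ ξ₂) g Ψ)⟫_ℂ =
        ⟪S.smear (F.ψ k₂ η₂) (fun z => starRingEnd ℂ (g z))
          (S.smear (F.ψ k₁ η₁) (fun z => starRingEnd ℂ (f z)) Φ), Ψ⟫_ℂ := fun hΦ hΨ => by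
    rw [hadj₁ hf hΦ (F.smear_mem_smoothVectors ξ₂ hg hΨ),
      hadj₂ hg (F.smear_mem_smoothVectors η₁ hf.star hΦ) hΨ]
  have move₂₁ : ∀ {Φ Ψ : 𝓗}, Φ ∈ smoothVectors S.L₀ → Ψ ∈ smoothVectors S.L₀ →
      ⟪Φ, S.smear (F.ψ h₂ ξ₂) g (S.smear (F.ψ h₁ ξ₁) f Ψ)⟫_ℂ =
        ⟪S.smear (F.ψ k₁ η₁) (fun z => starRingEnd ℂ (f z))
          (S.smear (F.ψ k₂ η₂) (fun z => starRingEnd ℂ (g z)) Φ), Ψ⟫_ℂ := fun hΦ hΨ => by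
    rw [hadj₂ hg hΦ (F.smear_mem_smoothVectors ξ₁ hf hΨ),
      hadj₁ hf (F.smear_mem_smoothVectors η₂ hg.star hΦ) hΨ]
  refine S.eq_of_inner_homog fun j y hy => ?_
  have hys := S.homog_le_smoothVectors j hy
  -- The adjoints move both products to the test vector `y`, where it suffices to compare the
  -- components of definite charge and energy: no continuity in `Ψ` has to be shown.
  rw [inner_smul_right, move₁₂ hys hΨ, move₂₁ hys hΨ, ← inner_conj_symm, ← inner_conj_symm _ Ψ,
    ← Complex.conj_conj ε, ← map_mul, ← inner_smul_right]
  congr 2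
  refine S.eq_of_inner_homog fun i x hx => ?_
  have hxs := S.homog_le_smoothVectors i hx
  rw [inner_smul_right, ← inner_conj_symm, ← move₁₂ hys hxs, hmatrix i j x y hx hy, map_mul,
    move₂₁ hys hxs, inner_conj_symm]
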